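/- Two sensors $A$ and $B$ send status updates to a monitor. All service times are independent; those of sensor $A$ are exponential with rate $\mu_A>0$ and those of sensor $B$ exponential with rate $\mu_B>0$. Each sensor generates its first update at time $0$, starts serving an update at the instant it is generated, and generates its next update at the instant the previous one is delivered. The age of information at the monitor is $\Delta(t)=t-u(t)$, where $u(t)$ is the latest generation time among the updates delivered up to time $t$ (and $u(t)=0$ before the first delivery). An update is obsolete, and is discarded, if on delivery the monitor has already received an update that was generated strictly later. Let $A_{n}$ be the $n$-th peak age, that is, the value of $\Delta$ immediately before the delivery of the $n$-th non-obsolete update. Then the average peak age of information is $$\Delta^{\mathrm{peak}}_{\mathrm{M\text{-}M}}=\frac{2(\mu_A+\mu_B)}{\mu_A^2+\mu_A\mu_B+\mu_B^2},$$ in both senses: almost surely $\frac1N\sum_{n=1}^{N}A_n\to\Delta^{\mathrm{peak}}_{\mathrm{M\text{-}M}}$ as $N\to\infty$, and every $A_n$ is integrable with $\mathbb E[A_n]\to\Delta^{\mathrm{peak}}_{\mathrm{M\text{-}M}}$ as $n\to\infty$. -/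

import Mathlib

open MeasureTheory ProbabilityTheory Filter Topology

namespace DualQueue

/-- The two sensors. -/
inductive Sensor
  | A
  | B
  deriving DecidableEq

/-! A sample path is given by the service times: `s i k` is the service time of the `k`-th update
(`k = 0, 1, 2, …`) of sensor `i`. -/

/-- Generation time of the `k`-th update of sensor `i`. The first update is generated at time `0`;
every further one is generated (and its service starts) at the instant the previous update of the
same sensor is delivered (zero wait, instantaneous acknowledgment). -/
def generationTime (s : Sensor → ℕ → ℝ) (i : Sensor) (k : ℕ) : ℝ :=
  ∑ j ∈ Finset.range k, s i j

/-- Delivery time of the `k`-th update of sensor `i`: its service starts when it is generated. -/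
def deliveryTime (s : Sensor → ℕ → ℝ) (i : Sensor) (k : ℕ) : ℝ :=
  generationTime s i k + s i k

/-- If sensor `i` is currently serving its update number `c i`, this is the sensor whose current
update is delivered first. -/
noncomputable def nextSensor (s : Sensor → ℕ → ℝ) (c : Sensor → ℕ) : Sensor :=
  if deliveryTime s Sensor.A (c Sensor.A) ≤ deliveryTime s Sensor.B (c Sensor.B)
  then Sensor.A else Sensor.B

/-- `served s m i` is the number of updates of sensor `i` among the first `m` deliveries of the
system; equivalently, the number of the update that sensor `i` serves after these deliveries. -/
noncomputable def served (s : Sensor → ℕ → ℝ) : ℕ → Sensor → ℕ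
  | 0 => fun _ => 0
  | m + 1 => fun i => served s m i + if i = nextSensor s (served s m) then 1 else 0

/-- The sensor that makes delivery number `m = 0, 1, 2, …`, where the deliveries of both sensors
(obsolete ones included) are counted together in chronological order. -/
noncomputable def sensorAt (s : Sensor → ℕ → ℝ) (m : ℕ) : Sensor :=
  nextSensor s (served s m)

/-- The time of delivery number `m`. -/
noncomputable def arrival (s : Sensor → ℕ → ℝ) (m : ℕ) : ℝ :=
  deliveryTime s (sensorAt s m) (served s m (sensorAt s m))

/-- The generation time (time stamp) of the update in delivery number `m`. -/
noncomputable def stamp (s : Sensor → ℕ → ℝ) (m : ℕ) : ℝ :=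
  generationTime s (sensorAt s m) (served s m (sensorAt s m))

/-- The update in delivery number `m` is obsolete (and discarded): when it arrives, the monitor has
already received an update that was generated later, so its age exceeds the age at the monitor. -/
def Obsolete (s : Sensor → ℕ → ℝ) (m : ℕ) : Prop :=
  ∃ l < m, stamp s m < stamp s l

/-- The time at which the `n`-th (`n = 0, 1, 2, …`) non-obsolete update is received. -/
noncomputable def successTime (s : Sensor → ℕ → ℝ) (n : ℕ) : ℝ :=
  arrival s (Nat.nth (fun m => ¬ Obsolete s m) n)

/-- The age of information at the monitor, `Δ(t) = t - u(t)`, where `u(t)` is the latest time stamp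
received up to time `t`. The age is `0` at time `0`. -/
noncomputable def aoi (s : Sensor → ℕ → ℝ) (t : ℝ) : ℝ :=
  t - sSup (insert 0 {u | ∃ m, arrival s m ≤ t ∧ u = stamp s m})

/-- The `n`-th peak age: the age of information immediately before the `n`-th non-obsolete update
is received. -/
noncomputable def peakAoI (s : Sensor → ℕ → ℝ) (n : ℕ) : ℝ :=
  Function.leftLim (aoi s) (successTime s n)

end DualQueue

namespace DualQueue

/-! Merge the deliveries of both sensors: delivery m comes from sensor x m, and `gap m` is the time
since the previous delivery. By memorylessness the loser of a race still needs a fresh exponential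
service, so what follows a delivery is distributed as the whole path and is independent of the pair
(gap, winner); this is `map_race_residual`. Hence the gaps are i.i.d. exponential of rate μ_A + μ_B,
the sensors are i.i.d. with probabilities a = μ_A/(μ_A + μ_B) and b = 1 - a, and the two sequences
are independent.

The rest is local. Delivery j+2 is obsolete exactly when x j = x (j+1) ≠ x (j+2)
(`obsolete_add_two_iff`), an event of probability ab. The age just before it is gap (j+2) + gap
(j+1), plus gap j if x j ≠ x (j+1) (`leftLim_aoi_arrival_add_two`).

Almost sure limit: averaged over all deliveries, the age counted at successes only tends to 2/(μ_A +
μ_B) and the success indicator to 1 - ab. Both observe three consecutive races, so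
`strong_law_shift` applies, and `tendsto_sum_ageBefore` takes the quotient.

Limit of means: which delivery is the n-th success depends on the sensors only, so the mean peak is
(2 + p_n)/(μ_A + μ_B), with p_n the probability that the two deliveries before it come from
different sensors. The last two sensors at successes form a four-state Markov chain; a Doeblin
contraction (`exists_chainStep_iterate_mem`) gives p_n → 2ab/(1 - ab). Both limits equal 2/((μ_A +
μ_B)(1 - ab)). -/

theorem Sensor.eq_of_ne_of_ne {a b c : Sensor} (hab : a ≠ b) (hcb : c ≠ b) : a = c := by
  cases a <;> cases b <;> cases c <;> simp_all

/-- The time of the `m`-th delivery, counted from `1`, with `epoch s 0 = 0`. -/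
noncomputable def epoch (s : Sensor → ℕ → ℝ) : ℕ → ℝ
  | 0 => 0
  | m + 1 => arrival s m

/-- The start of the service that sensor `i` performs after `m` deliveries of the system. -/
noncomputable def serviceStart (s : Sensor → ℕ → ℝ) (m : ℕ) (i : Sensor) : ℝ :=
  generationTime s i (served s m i)

/-- The pattern of delivering sensors that makes delivery `j + 2` obsolete. -/
def Overtaken (x : ℕ → Sensor) (j : ℕ) : Prop :=
  x j = x (j + 1) ∧ x (j + 2) ≠ x (j + 1)

instance (x : ℕ → Sensor) : DecidablePred (Overtaken x) := fun j => by
  unfold Overtaken; infer_instance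

/-- The age just before delivery `j + 2`, from the delivering sensors and the times between
deliveries. -/
noncomputable def ageBefore (x : ℕ → Sensor) (d : ℕ → ℝ) (j : ℕ) : ℝ :=
  d (j + 2) + d (j + 1) + if x j = x (j + 1) then 0 else d j

/-! ### Deterministic description of stamps, obsolescence and age -/

section Path

variable {s : Sensor → ℕ → ℝ}

theorem stamp_eq_serviceStart (m : ℕ) : stamp s m = serviceStart s m (sensorAt s m) := rfl

theorem serviceStart_zero (i : Sensor) : serviceStart s 0 i = 0 := by
  simp [serviceStart, served, generationTime]

theorem serviceStart_succ_self (m : ℕ) :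
    serviceStart s (m + 1) (sensorAt s m) = epoch s (m + 1) := by
  simp only [serviceStart, served, epoch, arrival, deliveryTime, sensorAt, if_true,
    generationTime, Finset.sum_range_succ]

theorem serviceStart_succ_of_ne {m : ℕ} {i : Sensor} (h : i ≠ sensorAt s m) :
    serviceStart s (m + 1) i = serviceStart s m i := by
  have : i ≠ nextSensor s (served s m) := h
  simp [serviceStart, served, this]

theorem serviceStart_le (hs : StrictMono (epoch s)) (m : ℕ) (i : Sensor) :
    serviceStart s m i ≤ epoch s m := by
  induction m with
  | zero => simp [serviceStart_zero, epoch]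
  | succ m ih =>
    by_cases h : i = sensorAt s m
    · rw [h, serviceStart_succ_self]
    · rw [serviceStart_succ_of_ne h]
      exact ih.trans (hs.monotone m.le_succ)

theorem serviceStart_nonneg (hs : StrictMono (epoch s)) (m : ℕ) (i : Sensor) :
    0 ≤ serviceStart s m i := by
  induction m with
  | zero => simp [serviceStart_zero]
  | succ m ih =>
    by_cases h : i = sensorAt s m
    · rw [h, serviceStart_succ_self]
      exact hs.monotone (Nat.zero_le (m + 1))
    · rwa [serviceStart_succ_of_ne h]

theorem stamp_le (hs : StrictMono (epoch s)) (m : ℕ) : stamp s m ≤ epoch s m :=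
  serviceStart_le hs _ _

theorem stamp_nonneg (hs : StrictMono (epoch s)) (m : ℕ) : 0 ≤ stamp s m :=
  serviceStart_nonneg hs _ _

theorem stamp_zero : stamp s 0 = 0 := serviceStart_zero _

theorem stamp_succ_of_eq {m : ℕ} (h : sensorAt s (m + 1) = sensorAt s m) :
    stamp s (m + 1) = epoch s (m + 1) := by
  rw [stamp_eq_serviceStart, h, serviceStart_succ_self]

theorem stamp_succ_le_of_ne (hs : StrictMono (epoch s)) {m : ℕ}
    (h : sensorAt s (m + 1) ≠ sensorAt s m) : stamp s (m + 1) ≤ epoch s m := by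
  rw [stamp_eq_serviceStart, serviceStart_succ_of_ne h]
  exact serviceStart_le hs _ _

/-- With two sensors, two consecutive changes lead back to the sensor of delivery m, which started
its next service at that delivery. -/
theorem stamp_add_two_of_ne {m : ℕ} (h : sensorAt s (m + 2) ≠ sensorAt s (m + 1))
    (h' : sensorAt s (m + 1) ≠ sensorAt s m) : stamp s (m + 2) = epoch s (m + 1) := by
  rw [stamp_eq_serviceStart, serviceStart_succ_of_ne h, Sensor.eq_of_ne_of_ne h h'.symm,
    serviceStart_succ_self]

/-- Stamps of deliveries before m are at most `epoch s (m - 1)`. The truncated subtraction lets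
deliveries 0 and 1 share the bound `epoch s 0 = 0`. -/
theorem not_obsolete_of_epoch_le (hs : StrictMono (epoch s)) {m : ℕ}
    (h : epoch s (m - 1) ≤ stamp s m) : ¬ Obsolete s m := by
  rintro ⟨l, hl, hlt⟩
  have := (stamp_le hs l).trans (hs.monotone (Nat.le_sub_one_of_lt hl))
  linarith

theorem not_obsolete_zero (hs : StrictMono (epoch s)) : ¬ Obsolete s 0 :=
  not_obsolete_of_epoch_le hs (stamp_nonneg hs 0)

theorem not_obsolete_one (hs : StrictMono (epoch s)) : ¬ Obsolete s 1 :=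
  not_obsolete_of_epoch_le hs (stamp_nonneg hs 1)

/-- A repeated sensor delivers an update generated at the preceding delivery, and a double change
one generated at delivery j; nothing received is newer. In the remaining pattern the update was
already in service before delivery j, while delivery j+1 carries one generated at delivery j. -/
theorem obsolete_add_two_iff (hs : StrictMono (epoch s)) (j : ℕ) :
    Obsolete s (j + 2) ↔ Overtaken (sensorAt s) j := by
  unfold Overtaken
  by_cases h : sensorAt s (j + 2) = sensorAt s (j + 1)
  · simp only [h, ne_eq, not_true_eq_false, and_false, iff_false]
    refine not_obsolete_of_epoch_le hs ?_
    rw [stamp_succ_of_eq h]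
    exact hs.monotone (by lia)
  · by_cases h' : sensorAt s (j + 1) = sensorAt s j
    · simp only [h', ne_eq, true_and]
      refine iff_of_true ⟨j + 1, by lia, ?_⟩ (by rwa [← h'])
      rw [stamp_succ_of_eq h']
      have h'' : sensorAt s (j + 2) ≠ sensorAt s j := by rwa [← h']
      rw [stamp_eq_serviceStart, serviceStart_succ_of_ne h, serviceStart_succ_of_ne h'']
      exact (serviceStart_le hs _ _).trans_lt (hs j.lt_succ_self)
    · refine iff_of_false (not_obsolete_of_epoch_le hs ?_) (fun H => h' H.1.symm)
      rw [stamp_add_two_of_ne h h']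
      exact le_rfl

/-- The latest time stamp received in deliveries `0, …, m + 1`. -/
theorem isGreatest_stamp (hs : StrictMono (epoch s)) (m : ℕ) :
    IsGreatest (insert 0 {u | ∃ l < m + 2, u = stamp s l})
      (if sensorAt s m = sensorAt s (m + 1) then epoch s (m + 1) else epoch s m) := by
  have hnn : ∀ l, 0 ≤ epoch s l := fun l => hs.monotone (Nat.zero_le l)
  split_ifs with h
  · refine ⟨Or.inr ⟨m + 1, by lia, (stamp_succ_of_eq h.symm).symm⟩, ?_⟩
    rintro u (rfl | ⟨l, hl, rfl⟩)
    · exact hnn _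
    · exact (stamp_le hs l).trans (hs.monotone (by lia))
  · refine ⟨?_, ?_⟩
    · cases m with
      | zero => exact Or.inl rfl
      | succ m =>
        by_cases h' : sensorAt s (m + 1) = sensorAt s m
        · exact Or.inr ⟨m + 1, by lia, (stamp_succ_of_eq h').symm⟩
        · exact Or.inr ⟨m + 2, by lia, (stamp_add_two_of_ne (Ne.symm h) h').symm⟩
    · rintro u (rfl | ⟨l, hl, rfl⟩)
      · exact hnn _
      · rcases Nat.lt_succ_iff_lt_or_eq.1 hl with hl | rfl
        · exact (stamp_le hs l).trans (hs.monotone (by lia))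
        · exact stamp_succ_le_of_ne hs (Ne.symm h)

/-- No delivery falls strictly between `epoch s m` and `arrival s m`, so there the latest stamp is
constant and the age is affine. -/
theorem leftLim_aoi_arrival (hs : StrictMono (epoch s)) {m : ℕ} {U : ℝ}
    (hU : IsGreatest (insert 0 {u | ∃ l < m, u = stamp s l}) U) :
    Function.leftLim (aoi s) (arrival s m) = arrival s m - U := by
  have hlt : epoch s m < arrival s m := hs m.lt_succ_self
  refine leftLim_eq_of_tendsto ?_
  have : Tendsto (fun t : ℝ => t - U) (𝓝[<] arrival s m) (𝓝 (arrival s m - U)) :=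
    ((continuous_id.sub continuous_const).tendsto _).mono_left nhdsWithin_le_nhds
  refine this.congr' ?_
  filter_upwards [Ioo_mem_nhdsLT hlt] with t ht
  have hset : {u | ∃ l, arrival s l ≤ t ∧ u = stamp s l} = {u | ∃ l < m, u = stamp s l} := by
    ext u
    refine exists_congr fun l => and_congr_left fun _ => ⟨fun h => ?_, fun h => ?_⟩
    · have : epoch s (l + 1) < epoch s (m + 1) := lt_of_le_of_lt h ht.2
      have := hs.lt_iff_lt.1 this
      lia
    · have : epoch s (l + 1) ≤ epoch s m := hs.monotone h
      exact this.trans ht.1.le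
  rw [aoi, hset, hU.csSup_eq]

theorem leftLim_aoi_arrival_zero (hs : StrictMono (epoch s)) :
    Function.leftLim (aoi s) (arrival s 0) = arrival s 0 := by
  rw [leftLim_aoi_arrival hs (U := 0), sub_zero]
  simp [isGreatest_singleton]

theorem leftLim_aoi_arrival_one (hs : StrictMono (epoch s)) :
    Function.leftLim (aoi s) (arrival s 1) = arrival s 1 := by
  rw [leftLim_aoi_arrival hs (U := 0), sub_zero]
  simp [stamp_zero, isGreatest_singleton]

theorem leftLim_aoi_arrival_add_two (hs : StrictMono (epoch s)) (j : ℕ) :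
    Function.leftLim (aoi s) (arrival s (j + 2)) =
      ageBefore (sensorAt s) (fun k => epoch s (k + 1) - epoch s k) j := by
  rw [leftLim_aoi_arrival hs (isGreatest_stamp hs j), ageBefore]
  have : arrival s (j + 2) = epoch s (j + 3) := rfl
  split_ifs <;> rw [this] <;> ring_nf

end Path

/-! ### Positions of the successes in a sequence of sensors -/

section Pattern

/-- An obsolete delivery changes sensor, whereas the pattern for the next one would need a
repetition: obsolete deliveries are never adjacent. -/
theorem not_overtaken_succ {x : ℕ → Sensor} {j : ℕ} (h : Overtaken x j) :
    ¬ Overtaken x (j + 1) := fun h' => h.2 h'.1.symm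

theorem infinite_not_overtaken (x : ℕ → Sensor) :
    (Set.ofPred fun j => ¬ Overtaken x j).Infinite := by
  refine Set.infinite_of_forall_exists_gt fun a => ?_
  by_cases h : Overtaken x (a + 1)
  · exact ⟨a + 2, not_overtaken_succ h, by lia⟩
  · exact ⟨a + 1, h, by lia⟩

/-- The `n`-th index `j` such that delivery `j + 2` is not obsolete. -/
noncomputable def successIndex (x : ℕ → Sensor) (n : ℕ) : ℕ :=
  Nat.nth (fun j => ¬ Overtaken x j) n

theorem successIndex_eq_of_count {x : ℕ → Sensor} {n j : ℕ} (hj : ¬ Overtaken x j)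
    (hc : Nat.count (fun j => ¬ Overtaken x j) j = n) : successIndex x n = j := by
  rw [← hc]
  exact Nat.nth_count (p := fun j => ¬ Overtaken x j) hj

theorem not_overtaken_successIndex (x : ℕ → Sensor) (n : ℕ) : ¬ Overtaken x (successIndex x n) :=
  Nat.nth_mem_of_infinite (infinite_not_overtaken x) n

theorem count_successIndex (x : ℕ → Sensor) (n : ℕ) :
    Nat.count (fun j => ¬ Overtaken x j) (successIndex x n) = n :=
  Nat.count_nth_of_infinite (infinite_not_overtaken x) n

theorem successIndex_zero_of_not {x : ℕ → Sensor} (h : ¬ Overtaken x 0) : successIndex x 0 = 0 :=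
  successIndex_eq_of_count h rfl

/-- Together with `successIndex_of_overtaken`, this gives a recursion under the shift, so that
expectations can be computed by peeling off the first delivery. -/
theorem successIndex_succ_of_not {x : ℕ → Sensor} (h : ¬ Overtaken x 0) (n : ℕ) :
    successIndex x (n + 1) = successIndex (fun k => x (k + 1)) n + 1 := by
  refine successIndex_eq_of_count (not_overtaken_successIndex (fun k => x (k + 1)) n) ?_
  rw [Nat.count_succ', if_pos h]
  exact congrArg (· + 1) (count_successIndex (fun k => x (k + 1)) n)

theorem successIndex_of_overtaken {x : ℕ → Sensor} (h : Overtaken x 0) (n : ℕ) :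
    successIndex x n = successIndex (fun k => x (k + 1)) n + 1 := by
  refine successIndex_eq_of_count (not_overtaken_successIndex (fun k => x (k + 1)) n) ?_
  rw [Nat.count_succ', if_neg (not_not.2 h)]
  exact count_successIndex (fun k => x (k + 1)) n

end Pattern

/-! ### Peak ages in terms of sensors and gaps -/

section Peak

variable {s : Sensor → ℕ → ℝ}

theorem nth_not_obsolete_zero (hs : StrictMono (epoch s)) :
    Nat.nth (fun m => ¬ Obsolete s m) 0 = 0 :=
  Nat.nth_zero_of_zero (not_obsolete_zero hs)

open Classical in
theorem nth_not_obsolete_one (hs : StrictMono (epoch s)) :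
    Nat.nth (fun m => ¬ Obsolete s m) 1 = 1 := by
  have : Nat.count (fun m => ¬ Obsolete s m) 1 = 1 := by
    rw [Nat.count_one, if_pos (not_obsolete_zero hs)]
  conv_lhs => rw [← this]
  exact Nat.nth_count (p := fun m => ¬ Obsolete s m) (not_obsolete_one hs)

open Classical in
-- Both offsets by 2 agree because deliveries 0 and 1 are never obsolete.
theorem nth_not_obsolete_add_two (hs : StrictMono (epoch s)) (n : ℕ) :
    Nat.nth (fun m => ¬ Obsolete s m) (n + 2) = successIndex (sensorAt s) n + 2 := by
  have h := not_overtaken_successIndex (sensorAt s) n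
  rw [← obsolete_add_two_iff hs] at h
  have hc : Nat.count (fun m => ¬ Obsolete s m) (successIndex (sensorAt s) n + 2) = n + 2 := by
    rw [Nat.count_succ', Nat.count_succ', if_pos (not_obsolete_zero hs),
      if_pos (not_obsolete_one hs)]
    have := count_successIndex (sensorAt s) n
    simp_rw [← obsolete_add_two_iff hs] at this
    convert congrArg (· + 2) this
  conv_lhs => rw [← hc]
  exact Nat.nth_count (p := fun m => ¬ Obsolete s m) h

theorem peakAoI_zero (hs : StrictMono (epoch s)) : peakAoI s 0 = arrival s 0 := by
  rw [peakAoI, successTime, nth_not_obsolete_zero hs, leftLim_aoi_arrival_zero hs]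

theorem peakAoI_one (hs : StrictMono (epoch s)) : peakAoI s 1 = arrival s 1 := by
  rw [peakAoI, successTime, nth_not_obsolete_one hs, leftLim_aoi_arrival_one hs]

theorem peakAoI_add_two (hs : StrictMono (epoch s)) (n : ℕ) :
    peakAoI s (n + 2) = ageBefore (sensorAt s) (fun k => epoch s (k + 1) - epoch s k)
      (successIndex (sensorAt s) n) := by
  rw [peakAoI, successTime, nth_not_obsolete_add_two hs, leftLim_aoi_arrival_add_two hs]

end Peak

open scoped ENNReal

/-! ### Memorylessness and the race of two exponential clocks -/

section Exponential

theorem lintegral_expMeasure (r : ℝ) {f : ℝ → ℝ≥0∞} (hf : Measurable f) :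
    ∫⁻ x, f x ∂expMeasure r = ∫⁻ x, exponentialPDF r x * f x := by
  have hm : Measurable (exponentialPDF r) := (measurable_exponentialPDFReal r).ennreal_ofReal
  exact lintegral_withDensity_eq_lintegral_mul _ hm hf

instance nullSingletonClass_expMeasure (r : ℝ) : NullSingletonClass (expMeasure r) where
  measure_singleton x :=
    (withDensity_absolutelyContinuous (μ := volume) (exponentialPDF r)) (measure_singleton x)

theorem lintegral_expMeasure_residual {r : ℝ} {a : ℝ} (ha : 0 ≤ a) {f : ℝ → ℝ≥0∞}
    (hf : Measurable f) :
    ∫⁻ b, (if a ≤ b then f (b - a) else 0) ∂expMeasure r =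
      ENNReal.ofReal (Real.exp (-(r * a))) * ∫⁻ x, f x ∂expMeasure r := by
  have hm : Measurable (exponentialPDF r) := (measurable_exponentialPDFReal r).ennreal_ofReal
  rw [lintegral_expMeasure r (Measurable.ite measurableSet_Ici (by fun_prop) measurable_const),
    lintegral_expMeasure r hf, ← lintegral_const_mul _ (by fun_prop),
    -- Translating by a turns the density at x into the density at x + a, which differs by the
    -- factor exp(-ra).
    ← lintegral_add_right_eq_self _ a]
  refine lintegral_congr fun x => ?_
  rcases lt_or_ge x 0 with hx | hx
  · simp [exponentialPDF_of_neg hx, hx.not_ge]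
  · rw [if_pos (by linarith), add_sub_cancel_right, exponentialPDF_of_nonneg hx,
      exponentialPDF_of_nonneg (by linarith), ← mul_assoc,
      ← ENNReal.ofReal_mul (Real.exp_nonneg _)]
    congr 2
    rw [mul_add, neg_add, Real.exp_add]
    ring

/-- Race of two independent exponential clocks, on the event that the first one wins: the winning
time and the residual time of the loser are again independent and exponential. -/
theorem lintegral_race {α β : ℝ} (hα : 0 < α) (hβ : 0 < β) {f : ℝ × ℝ → ℝ≥0∞}
    (hf : Measurable f) :
    ∫⁻ a, ∫⁻ b, (if a ≤ b then f (a, b - a) else 0) ∂expMeasure β ∂expMeasure α =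
      ENNReal.ofReal (α / (α + β)) *
        ∫⁻ d, ∫⁻ r, f (d, r) ∂expMeasure β ∂expMeasure (α + β) := by
  have hm (r : ℝ) : Measurable (exponentialPDF r) :=
    (measurable_exponentialPDFReal r).ennreal_ofReal
  have := isProbabilityMeasure_expMeasure hβ
  have h1 : Measurable fun a => ∫⁻ b, (if a ≤ b then f (a, b - a) else 0) ∂expMeasure β := by
    refine Measurable.lintegral_prod_right' (f := fun z : ℝ × ℝ =>
      if z.1 ≤ z.2 then f (z.1, z.2 - z.1) else 0) ?_
    exact Measurable.ite (measurableSet_le measurable_fst measurable_snd) (by fun_prop)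
      measurable_const
  have h2 : Measurable fun d => ∫⁻ r, f (d, r) ∂expMeasure β := hf.lintegral_prod_right'
  rw [lintegral_expMeasure _ h1, lintegral_expMeasure _ h2,
    ← lintegral_const_mul _ (by fun_prop)]
  refine lintegral_congr fun a => ?_
  rcases lt_or_ge a 0 with ha | ha
  · simp [exponentialPDF_of_neg ha]
  · rw [lintegral_expMeasure_residual (f := fun r => f (a, r)) ha (by fun_prop), ← mul_assoc,
      ← mul_assoc]
    congr 1
    rw [exponentialPDF_of_nonneg ha, exponentialPDF_of_nonneg ha,
      ← ENNReal.ofReal_mul (by positivity), ← ENNReal.ofReal_mul (by positivity)]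
    congr 1
    -- The loser's survival factor exp(-βa) turns the density of rate α into α/(α + β) times the
    -- density of rate α + β.
    have : Real.exp (-((α + β) * a)) = Real.exp (-(α * a)) * Real.exp (-(β * a)) := by
      rw [← Real.exp_add]; ring_nf
    rw [this]
    field_simp

theorem lintegral_race' {α β : ℝ} (hα : 0 < α) (hβ : 0 < β) {f : ℝ × ℝ → ℝ≥0∞}
    (hf : Measurable f) :
    ∫⁻ a, ∫⁻ b, (if a ≤ b then 0 else f (b, a - b)) ∂expMeasure β ∂expMeasure α =
      ENNReal.ofReal (β / (α + β)) *
        ∫⁻ d, ∫⁻ r, f (d, r) ∂expMeasure α ∂expMeasure (α + β) := by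
  have := isProbabilityMeasure_expMeasure hα
  have := isProbabilityMeasure_expMeasure hβ
  rw [add_comm α β, ← lintegral_race hβ hα hf, lintegral_lintegral_swap]
  -- Exchanging the clocks turns a strict inequality into a weak one; ties are null because the
  -- exponential law has no atoms.
  · refine lintegral_congr fun b => lintegral_congr_ae ?_
    have : ∀ᵐ a ∂expMeasure α, a ≠ b := by simp [ae_iff, measure_singleton]
    filter_upwards [this] with a ha
    by_cases h : b ≤ a
    · rw [if_pos h, if_neg (not_le.2 (lt_of_le_of_ne h ha.symm))]
    · rw [if_neg h, if_pos (not_le.1 h).le]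
  · refine Measurable.aemeasurable ?_
    exact Measurable.ite (measurableSet_le measurable_fst measurable_snd) measurable_const
      (by fun_prop)

end Exponential

/-! ### The law of the sample path -/

instance : MeasurableSpace Sensor := ⊤

instance : DiscreteMeasurableSpace Sensor := ⟨fun _ => trivial⟩

instance : Fintype Sensor := ⟨{Sensor.A, Sensor.B}, fun i => by cases i <;> simp⟩

/-- The law of a sample path all of whose service times are independent, those of sensor `i` being
distributed according to `law i`. -/
noncomputable def pathLaw (law : Sensor → Measure ℝ) [∀ i, IsProbabilityMeasure (law i)] :
    Measure (Sensor → ℕ → ℝ) :=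
  (Measure.infinitePi fun p : Sensor × ℕ => law p.1).map fun s i k => s (i, k)

/-- Put a service time in front of the service times of sensor `i`. -/
def prepend (i : Sensor) (r : ℝ) (s : Sensor → ℕ → ℝ) : Sensor → ℕ → ℝ :=
  fun j k => if j = i then Nat.casesOn k r (s j) else s j k

@[fun_prop]
theorem measurable_prepend (i : Sensor) :
    Measurable fun z : ℝ × (Sensor → ℕ → ℝ) => prepend i z.1 z.2 := by
  refine measurable_pi_lambda _ fun j => measurable_pi_lambda _ fun k => ?_
  by_cases h : j = i
  · cases k <;> simp only [prepend, h, if_true] <;> fun_prop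
  · simp only [prepend, h, if_false]; fun_prop

section PathLaw

variable (law : Sensor → Measure ℝ) [∀ i, IsProbabilityMeasure (law i)]

instance : IsProbabilityMeasure (pathLaw law) :=
  Measure.isProbabilityMeasure_map
    (by fun_prop : Measurable fun (s : Sensor × ℕ → ℝ) i k => s (i, k)).aemeasurable

/-- Shifting the indices of sensor i by one is injective and misses only (i, 0). Under the product
measure the shifted family again has the product law and is independent of coordinate (i, 0). -/
theorem map_prepend_pathLaw (i : Sensor) :
    ((law i).prod (pathLaw law)).map (fun z => prepend i z.1 z.2) = pathLaw law := by
  let Q : Measure (Sensor × ℕ → ℝ) := Measure.infinitePi fun p : Sensor × ℕ => law p.1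
  let e : Sensor × ℕ → Sensor × ℕ := fun p => if p.1 = i then (p.1, p.2 + 1) else p
  let c : (Sensor × ℕ → ℝ) → Sensor → ℕ → ℝ := fun s i k => s (i, k)
  have he1 : ∀ p, (e p).1 = p.1 := fun p => by simp only [e]; split_ifs <;> rfl
  have he : Function.Injective e := by
    intro p q hpq
    have h1 : p.1 = q.1 := by rw [← he1 p, ← he1 q, hpq]
    simp only [e, h1] at hpq
    split_ifs at hpq with h
    · simp only [Prod.mk.injEq, true_and, Nat.add_right_cancel_iff] at hpq
      exact Prod.ext h1 hpq
    · exact hpq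
  have hne : ∀ p, e p ≠ (i, 0) := by
    intro p h
    have h1 : p.1 = i := by rw [← he1 p, h]
    simp [e, h1] at h
  have htail : Q.map (fun ω p => ω (e p)) = Q := by
    have := Measure.map_infinitePi_infinitePi_of_inj (P := fun p : Sensor × ℕ => law p.1) he
    refine this.trans ?_
    simp only [he1, Q]
  have hhead : Q.map (fun ω => ω (i, 0)) = law i :=
    Measure.infinitePi_map_eval (fun p : Sensor × ℕ => law p.1) (i, 0)
  have hind : IndepFun (fun ω : Sensor × ℕ → ℝ => ω (i, 0)) (fun ω p => ω (e p)) Q := by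
    have h : iIndepFun (fun p (ω : Sensor × ℕ → ℝ) => ω p) Q :=
      iIndepFun_infinitePi (X := fun _ x => x) (fun _ => measurable_id)
    have h' := indep_iSup_of_disjoint (fun p => (measurable_pi_apply p).comap_le) h.iIndep
      (disjoint_compl_right (a := ({(i, 0)} : Set (Sensor × ℕ))))
    refine indep_of_indep_of_le_left (indep_of_indep_of_le_right h' ?_) ?_
    · refine measurable_iff_comap_le.1 ((@measurable_pi_iff _ _ _ (_) _ _).2 fun p => ?_)
      exact measurable_iff_comap_le.2 (le_iSup₂_of_le (e p) (hne p) le_rfl)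
    · exact le_iSup₂_of_le (i, 0) rfl le_rfl
  have hprod : (law i).prod Q = Q.map fun ω => (ω (i, 0), fun p => ω (e p)) := by
    rw [(indepFun_iff_map_prod_eq_prod_map_map
      (by fun_prop : Measurable fun ω : Sensor × ℕ → ℝ => ω (i, 0)).aemeasurable
      (by fun_prop : Measurable fun (ω : Sensor × ℕ → ℝ) p => ω (e p)).aemeasurable).1 hind,
      htail, hhead]
  have hc : Measurable c := by fun_prop
  change ((law i).prod (Q.map c)).map _ = Q.map c
  conv_lhs => rw [← Measure.map_id (μ := law i)]
  rw [Measure.map_prod_map _ _ measurable_id hc, hprod, Measure.map_map (by fun_prop) (by fun_prop),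
    Measure.map_map (by fun_prop) (by fun_prop)]
  congr 1
  ext ω j k
  by_cases h : j = i
  · cases k <;> simp [prepend, c, e, h]
  · simp [prepend, c, e, h]

theorem lintegral_prepend (i : Sensor) {f : (Sensor → ℕ → ℝ) → ℝ≥0∞} (hf : Measurable f) :
    ∫⁻ r, ∫⁻ s, f (prepend i r s) ∂pathLaw law ∂law i = ∫⁻ s, f s ∂pathLaw law := by
  conv_rhs => rw [← map_prepend_pathLaw law i]
  rw [lintegral_map hf (measurable_prepend i), lintegral_prod _ (by fun_prop)]

end PathLaw

/-! ### The path seen from the first delivery -/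

/-- The services still to be performed after the first delivery, counted from that instant. -/
noncomputable def residual (s : Sensor → ℕ → ℝ) : Sensor → ℕ → ℝ := fun i k =>
  if i = sensorAt s 0 then s i (k + 1) else if k = 0 then s i 0 - arrival s 0 else s i k

section Residual

variable (s : Sensor → ℕ → ℝ)

theorem sensorAt_zero :
    sensorAt s 0 = if s Sensor.A 0 ≤ s Sensor.B 0 then Sensor.A else Sensor.B := by
  simp [sensorAt, nextSensor, served, deliveryTime, generationTime]

theorem arrival_zero : arrival s 0 = s (sensorAt s 0) 0 := by
  simp [arrival, served, deliveryTime, generationTime]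

/-- The winner's first service is the first delivery time itself; the loser's splits into that time
plus its remainder. Comparisons between sensors survive this common translation. -/
theorem deliveryTime_residual (i : Sensor) (k : ℕ) :
    deliveryTime s i (k + if i = sensorAt s 0 then 1 else 0) =
      arrival s 0 + deliveryTime (residual s) i k := by
  have h : ∀ (s : Sensor → ℕ → ℝ) i k, deliveryTime s i k = ∑ j ∈ Finset.range (k + 1), s i j :=
    fun s i k => (Finset.sum_range_succ _ _).symm
  rw [h, h]
  by_cases hi : i = sensorAt s 0
  · simp only [residual, hi, if_true, arrival_zero]
    rw [Finset.sum_range_succ', add_comm]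
  · simp only [residual, hi, if_false, add_zero]
    rw [Finset.sum_range_succ', Finset.sum_range_succ']
    simp only [Nat.add_eq_zero_iff, one_ne_zero, and_false, if_false, if_true]
    ring

theorem served_residual (m : ℕ) (i : Sensor) :
    served s (m + 1) i = served (residual s) m i + if i = sensorAt s 0 then 1 else 0 := by
  have hnext : ∀ c : Sensor → ℕ, nextSensor s (fun i => c i + if i = sensorAt s 0 then 1 else 0) =
      nextSensor (residual s) c := by
    intro c
    simp only [nextSensor, deliveryTime_residual, add_le_add_iff_left]
  induction m generalizing i with
  | zero => rfl
  | succ m ih =>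
    rw [served, funext ih, hnext, served]
    ring

theorem sensorAt_residual (m : ℕ) : sensorAt s (m + 1) = sensorAt (residual s) m := by
  rw [sensorAt, nextSensor, served_residual, served_residual, deliveryTime_residual,
    deliveryTime_residual, sensorAt, nextSensor]
  simp only [add_le_add_iff_left]

theorem arrival_residual (m : ℕ) : arrival s (m + 1) = arrival s 0 + arrival (residual s) m := by
  rw [arrival, sensorAt_residual, served_residual, deliveryTime_residual, ← arrival]

theorem sensorAt_eq_iterate (m : ℕ) : sensorAt s m = sensorAt (residual^[m] s) 0 := by
  induction m generalizing s with
  | zero => rfl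
  | succ m ih => rw [sensorAt_residual, ih, Function.iterate_succ_apply]

theorem epoch_succ_sub_epoch (m : ℕ) :
    epoch s (m + 1) - epoch s m = arrival (residual^[m] s) 0 := by
  induction m generalizing s with
  | zero => simp [epoch]
  | succ m ih =>
    rw [Function.iterate_succ_apply, ← ih (residual s)]
    cases m with
    | zero => simp [epoch, arrival_residual]
    | succ m => simp [epoch, arrival_residual s]

end Residual

@[fun_prop]
theorem measurable_sensorAt_zero : Measurable fun s : Sensor → ℕ → ℝ => sensorAt s 0 := by
  simp only [sensorAt_zero]
  exact Measurable.ite (measurableSet_le (by fun_prop) (by fun_prop)) measurable_const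
    measurable_const

@[fun_prop]
theorem measurable_arrival_zero : Measurable fun s : Sensor → ℕ → ℝ => arrival s 0 := by
  have : (fun s : Sensor → ℕ → ℝ => arrival s 0) = fun s => min (s Sensor.A 0) (s Sensor.B 0) := by
    ext s
    rw [arrival_zero, sensorAt_zero, min_def]
    split_ifs <;> rfl
  rw [this]
  fun_prop

@[fun_prop]
theorem measurable_residual : Measurable residual := by
  refine measurable_pi_lambda _ fun i => measurable_pi_lambda _ fun k => ?_
  refine Measurable.ite (measurable_sensorAt_zero (MeasurableSet.of_discrete (s := {j | i = j})))
    (by fun_prop) ?_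
  by_cases hk : k = 0
  · simp only [hk, if_true]; fun_prop
  · simp only [hk, if_false]; fun_prop

section Residual

variable (s : Sensor → ℕ → ℝ)

theorem sensorAt_prepend_zero (a b : ℝ) :
    sensorAt (prepend Sensor.A a (prepend Sensor.B b s)) 0 =
      if a ≤ b then Sensor.A else Sensor.B := by
  simp [sensorAt_zero, prepend]

theorem arrival_prepend_zero (a b : ℝ) :
    arrival (prepend Sensor.A a (prepend Sensor.B b s)) 0 = if a ≤ b then a else b := by
  rw [arrival_zero, sensorAt_prepend_zero]
  split_ifs <;> simp [prepend]

theorem residual_prepend (a b : ℝ) :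
    residual (prepend Sensor.A a (prepend Sensor.B b s)) =
      if a ≤ b then prepend Sensor.B (b - a) s else prepend Sensor.A (a - b) s := by
  ext i k
  rw [residual, sensorAt_prepend_zero, arrival_prepend_zero]
  split_ifs with h <;> cases i <;> cases k <;> simp_all [prepend]

end Residual

/-! ### Independence of the first race and the residual path -/

section Race

variable (μ : Sensor → ℝ)

/-- The law of the sensor that makes a given delivery. -/
noncomputable def winnerLaw : Measure Sensor :=
  ENNReal.ofReal (μ Sensor.A / (μ Sensor.A + μ Sensor.B)) • Measure.dirac Sensor.A +
    ENNReal.ofReal (μ Sensor.B / (μ Sensor.A + μ Sensor.B)) • Measure.dirac Sensor.B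

theorem lintegral_winnerLaw (f : Sensor → ℝ≥0∞) :
    ∫⁻ i, f i ∂winnerLaw μ =
      ENNReal.ofReal (μ Sensor.A / (μ Sensor.A + μ Sensor.B)) * f Sensor.A +
        ENNReal.ofReal (μ Sensor.B / (μ Sensor.A + μ Sensor.B)) * f Sensor.B := by
  simp [winnerLaw, lintegral_add_measure, lintegral_smul_measure]

variable {μ} in
theorem isProbabilityMeasure_winnerLaw (hμ : ∀ i, 0 < μ i) :
    IsProbabilityMeasure (winnerLaw μ) := by
  have hA := hμ Sensor.A
  have hB := hμ Sensor.B
  constructor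
  rw [← lintegral_one, lintegral_winnerLaw, mul_one, mul_one,
    ← ENNReal.ofReal_add (by positivity) (by positivity), ← add_div, div_self (by positivity),
    ENNReal.ofReal_one]

variable {μ} in
theorem isProbabilityMeasure_sum (hμ : ∀ i, 0 < μ i) :
    IsProbabilityMeasure (expMeasure (μ Sensor.A + μ Sensor.B)) :=
  isProbabilityMeasure_expMeasure (add_pos (hμ _) (hμ _))

/-- The joint law of the first delivery time and of the delivering sensor. -/
noncomputable def raceLaw : Measure (ℝ × Sensor) :=
  (expMeasure (μ Sensor.A + μ Sensor.B)).prod (winnerLaw μ)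

variable [∀ i, IsProbabilityMeasure (expMeasure (μ i))]

variable {μ} in
/-- The first delivery is independent of what happens afterwards, which is distributed as the whole
path. -/
theorem map_race_residual (hμ : ∀ i, 0 < μ i) :
    (pathLaw fun i => expMeasure (μ i)).map (fun s => ((arrival s 0, sensorAt s 0), residual s)) =
      (raceLaw μ).prod (pathLaw fun i => expMeasure (μ i)) := by
  have := isProbabilityMeasure_winnerLaw hμ
  have := isProbabilityMeasure_sum hμ
  set ν := pathLaw fun i => expMeasure (μ i) with hν
  refine Measure.ext_of_lintegral _ fun F hF => ?_
  have hFi (i : Sensor) : Measurable fun z : ℝ × (Sensor → ℕ → ℝ) => F ((z.1, i), z.2) := by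
    fun_prop
  have hf (i j : Sensor) : Measurable fun z : ℝ × ℝ => ∫⁻ t, F ((z.1, i), prepend j z.2 t) ∂ν := by
    refine Measurable.lintegral_prod_right'
      (f := fun z : (ℝ × ℝ) × (Sensor → ℕ → ℝ) => F ((z.1.1, i), prepend j z.1.2 z.2)) ?_
    have := measurable_prepend j
    fun_prop
  have hstep : Measurable fun s : Sensor → ℕ → ℝ =>
      F ((arrival s 0, sensorAt s 0), residual s) := by fun_prop
  -- Extract the first service times a of sensor A and b of sensor B; the path after them keeps the
  -- law ν and the race is between a and b alone.
  rw [lintegral_map hF (by fun_prop), hν, ← lintegral_prepend _ Sensor.A hstep]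
  have hinner : ∀ a, Measurable fun s : Sensor → ℕ → ℝ =>
      F ((arrival (prepend Sensor.A a s) 0, sensorAt (prepend Sensor.A a s) 0),
        residual (prepend Sensor.A a s)) := fun a =>
    hstep.comp ((measurable_prepend Sensor.A).comp (measurable_const.prodMk measurable_id))
  rw [lintegral_congr fun a =>
    (lintegral_prepend (fun i => expMeasure (μ i)) Sensor.B (hinner a)).symm]
  simp_rw [sensorAt_prepend_zero, arrival_prepend_zero, residual_prepend, ← hν]
  have hsplit : ∀ a b : ℝ,
      ∫⁻ t, F ((if a ≤ b then a else b, if a ≤ b then Sensor.A else Sensor.B),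
        if a ≤ b then prepend Sensor.B (b - a) t else prepend Sensor.A (a - b) t) ∂ν =
      (if a ≤ b then ∫⁻ t, F ((a, Sensor.A), prepend Sensor.B (b - a) t) ∂ν else 0) +
        if a ≤ b then 0 else ∫⁻ t, F ((b, Sensor.B), prepend Sensor.A (a - b) t) ∂ν := by
    intro a b
    split_ifs <;> simp
  have hA : Measurable fun z : ℝ × ℝ =>
      if z.1 ≤ z.2 then ∫⁻ t, F ((z.1, Sensor.A), prepend Sensor.B (z.2 - z.1) t) ∂ν else 0 := by
    refine Measurable.ite (measurableSet_le measurable_fst measurable_snd) ?_ measurable_const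
    exact (hf Sensor.A Sensor.B).comp (by fun_prop : Measurable fun z : ℝ × ℝ => (z.1, z.2 - z.1))
  -- After the race the loser's remaining time is a fresh exponential, so prepending it restores the
  -- full path law.
  have hloser (i j : Sensor) (d : ℝ) :
      ∫⁻ r, ∫⁻ t, F ((d, i), prepend j r t) ∂ν ∂expMeasure (μ j) = ∫⁻ t, F ((d, i), t) ∂ν :=
    lintegral_prepend (fun i => expMeasure (μ i)) j (f := fun t => F ((d, i), t)) (by fun_prop)
  have hmF (i : Sensor) : Measurable fun d => ∫⁻ t, F ((d, i), t) ∂ν :=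
    (hFi i).lintegral_prod_right'
  have hadd (a : ℝ) := lintegral_add_left (μ := expMeasure (μ Sensor.B))
    (hA.comp (measurable_prodMk_left (x := a)))
    (fun b => if a ≤ b then 0 else ∫⁻ t, F ((b, Sensor.B), prepend Sensor.A (a - b) t) ∂ν)
  simp only [Function.comp_def] at hadd
  simp_rw [hsplit, hadd]
  rw [lintegral_add_left hA.lintegral_prod_right', lintegral_race (hμ _) (hμ _) (hf _ _),
    lintegral_race' (hμ _) (hμ _) (hf _ _)]
  simp_rw [hloser]
  rw [lintegral_prod _ hF.aemeasurable, raceLaw,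
    lintegral_prod _ hF.lintegral_prod_right'.aemeasurable]
  simp_rw [lintegral_winnerLaw]
  rw [lintegral_add_left ((hmF _).const_mul _), lintegral_const_mul _ (hmF _),
    lintegral_const_mul _ (hmF _)]

end Race

/-! ### Independence along a measure-preserving shift -/

section Shift

variable {Ω E F G : Type*} [MeasurableSpace Ω] [MeasurableSpace E] [MeasurableSpace F]
  [MeasurableSpace G] {ν : Measure Ω} [IsProbabilityMeasure ν]

theorem indepFun_comp_of_measurePreserving {θ : Ω → Ω} (hθ : MeasurePreserving θ ν ν) {U : Ω → E}
    {V : Ω → F} (hU : Measurable U) (hV : Measurable V) (h : IndepFun U V ν) :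
    IndepFun (U ∘ θ) (V ∘ θ) ν := by
  rw [indepFun_iff_map_prod_eq_prod_map_map hU.aemeasurable hV.aemeasurable] at h
  rw [indepFun_iff_map_prod_eq_prod_map_map (hU.comp hθ.measurable).aemeasurable
    (hV.comp hθ.measurable).aemeasurable, ← Measure.map_map hU hθ.measurable,
    ← Measure.map_map hV hθ.measurable, hθ.map_eq, ← h]
  conv_rhs => rw [← hθ.map_eq]
  rw [Measure.map_map (hU.prodMk hV) hθ.measurable]
  rfl

/-- The law of (U, V ∘ θ, W ∘ θ) factors first as U against θ, then as V against W, because θ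
preserves ν. Iterating it makes a block of races independent of the path after the block. -/
theorem indepFun_prodMk_comp {θ : Ω → Ω} (hθ : MeasurePreserving θ ν ν) {U : Ω → E} {V : Ω → F}
    {W : Ω → G} (hU : Measurable U) (hV : Measurable V) (hW : Measurable W)
    (hUθ : IndepFun U θ ν) (hVW : IndepFun V W ν) :
    IndepFun (fun s => (U s, V (θ s))) (W ∘ θ) ν := by
  have hθm := hθ.measurable
  have : IsProbabilityMeasure (ν.map U) := Measure.isProbabilityMeasure_map hU.aemeasurable
  have : IsProbabilityMeasure (ν.map V) := Measure.isProbabilityMeasure_map hV.aemeasurable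
  have : IsProbabilityMeasure (ν.map W) := Measure.isProbabilityMeasure_map hW.aemeasurable
  have hUV := hUθ.comp measurable_id hV
  rw [indepFun_iff_map_prod_eq_prod_map_map (by fun_prop) (by fun_prop)] at hUV hUθ hVW ⊢
  simp only [Function.id_comp] at hUV
  have h1 : ν.map (V ∘ θ) = ν.map V := by rw [← Measure.map_map hV hθm, hθ.map_eq]
  have h2 : ν.map (W ∘ θ) = ν.map W := by rw [← Measure.map_map hW hθm, hθ.map_eq]
  rw [h1] at hUV
  rw [h2]
  refine Eq.trans ?_ (congrArg (fun m => m.prod (ν.map W)) hUV.symm)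
  rw [← (measurePreserving_prodAssoc (ν.map U) (ν.map V) (ν.map W)).symm.map_eq, ← hVW]
  conv_rhs => rw [← Measure.map_id (μ := ν.map U)]
  rw [Measure.map_prod_map _ _ measurable_id (hV.prodMk hW)]
  rw [hθ.map_eq] at hUθ
  rw [← hUθ, Measure.map_map (by fun_prop) (by fun_prop),
    Measure.map_map (by fun_prop) (by fun_prop)]
  rfl

end Shift

/-! ### Strong law for observables of three consecutive deliveries -/

section Average

theorem sum_range_eq_sum_mod_three (z : ℕ → ℝ) (N : ℕ) :
    ∑ m ∈ Finset.range N, z m = ∑ j ∈ Finset.range ((N + 2) / 3), z (3 * j + 0) +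
      ∑ j ∈ Finset.range ((N + 1) / 3), z (3 * j + 1) +
      ∑ j ∈ Finset.range ((N + 0) / 3), z (3 * j + 2) := by
  induction N with
  | zero => simp
  | succ N ih =>
    rw [Finset.sum_range_succ, ih]
    obtain ⟨M, rfl | rfl | rfl⟩ : ∃ M, N = 3 * M ∨ N = 3 * M + 1 ∨ N = 3 * M + 2 :=
      ⟨N / 3, by lia⟩
    · have e1 : (3 * M + 2) / 3 = M := by lia
      have e2 : (3 * M + 1) / 3 = M := by lia
      have e3 : (3 * M + 0) / 3 = M := by lia
      have e4 : (3 * M + 1 + 2) / 3 = M + 1 := by lia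
      rw [e1, e2, e3, e4, Finset.sum_range_succ]
      ring_nf
    · have e1 : (3 * M + 1 + 2) / 3 = M + 1 := by lia
      have e2 : (3 * M + 1 + 1) / 3 = M := by lia
      have e3 : (3 * M + 1 + 0) / 3 = M := by lia
      have e4 : (3 * M + 1 + 1 + 2) / 3 = M + 1 := by lia
      rw [e1, e2, e3, e4, Finset.sum_range_succ (fun j => z (3 * j + 1))]
      ring_nf
    · have e1 : (3 * M + 2 + 2) / 3 = M + 1 := by lia
      have e2 : (3 * M + 2 + 1) / 3 = M + 1 := by lia
      have e3 : (3 * M + 2 + 0) / 3 = M := by lia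
      have e4 : (3 * M + 2 + 1 + 2) / 3 = M + 1 := by lia
      rw [e1, e2, e3, e4, Finset.sum_range_succ (fun j => z (3 * j + 2))]
      ring_nf

theorem tendsto_add_div_three_div (r : ℕ) :
    Tendsto (fun N : ℕ => (((N + r) / 3 : ℕ) : ℝ) / N) atTop (𝓝 (1 / 3)) := by
  have h := (tendsto_const_div_atTop_nhds_zero_nat ((r : ℝ) + 3))
  rw [tendsto_iff_dist_tendsto_zero]
  refine squeeze_zero' (Eventually.of_forall fun _ => dist_nonneg) ?_ h
  filter_upwards [eventually_gt_atTop 0] with N hN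
  have hN' : (0 : ℝ) < N := by exact_mod_cast hN
  have h1 : (((N + r) / 3 : ℕ) : ℝ) * 3 ≤ N + r := by
    exact_mod_cast Nat.div_mul_le_self (N + r) 3
  have h2 : (N : ℝ) + r ≤ (((N + r) / 3 : ℕ) : ℝ) * 3 + 3 := by
    have : N + r ≤ (N + r) / 3 * 3 + 3 := by lia
    exact_mod_cast this
  have hr : (0 : ℝ) ≤ r := r.cast_nonneg
  rw [Real.dist_eq, div_sub_div _ _ hN'.ne' (by norm_num), abs_div,
    abs_of_pos (by positivity : (0 : ℝ) < N * 3), div_le_div_iff₀ (by positivity) hN']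
  have : |(((N + r) / 3 : ℕ) : ℝ) * 3 - N * 1| ≤ r + 3 := by
    rw [abs_le]; constructor <;> linarith
  nlinarith

theorem tendsto_average_of_mod_three {z : ℕ → ℝ} {c : ℝ}
    (h : ∀ r, Tendsto (fun N : ℕ => (∑ j ∈ Finset.range N, z (3 * j + r)) / (N : ℝ)) atTop (𝓝 c)) :
    Tendsto (fun N : ℕ => (∑ m ∈ Finset.range N, z m) / (N : ℝ)) atTop (𝓝 c) := by
  have key (i r : ℕ) : Tendsto (fun N : ℕ =>
      (∑ j ∈ Finset.range ((N + i) / 3), z (3 * j + r)) / (N : ℝ)) atTop (𝓝 (c * (1 / 3))) := by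
    have hφ : Tendsto (fun N : ℕ => (N + i) / 3) atTop atTop :=
      (Nat.tendsto_div_const_atTop (by norm_num)).comp (tendsto_add_atTop_nat i)
    refine (((h r).comp hφ).mul (tendsto_add_div_three_div i)).congr' ?_
    filter_upwards [hφ.eventually_gt_atTop 0] with N hN
    have : (((N + i) / 3 : ℕ) : ℝ) ≠ 0 := by exact_mod_cast hN.ne'
    simp only [Function.comp_apply]
    field_simp
  have := ((key 2 0).add (key 1 1)).add (key 0 2)
  rw [← mul_add, ← mul_add, show (1 / 3 + 1 / 3 + 1 / 3 : ℝ) = 1 by norm_num, mul_one] at this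
  refine this.congr fun N => ?_
  rw [sum_range_eq_sum_mod_three z N, add_div, add_div]

/-- Strong law of large numbers along the orbit of a shift, for an observable that is independent
of the third iterate of the shift. -/
theorem strong_law_shift {Ω : Type*} [MeasurableSpace Ω] {ν : Measure Ω} [IsProbabilityMeasure ν]
    {θ : Ω → Ω} (hθ : MeasurePreserving θ ν ν) {Z : Ω → ℝ} (hZ : Measurable Z)
    (hint : Integrable Z ν) (hind : IndepFun Z (θ^[3]) ν) :
    ∀ᵐ s ∂ν, Tendsto (fun N : ℕ => (∑ m ∈ Finset.range N, Z (θ^[m] s)) / (N : ℝ)) atTop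
      (𝓝 (∫ s, Z s ∂ν)) := by
  have hmp (m : ℕ) : MeasurePreserving (Z ∘ θ^[m]) ν (ν.map Z) :=
    (hZ.measurePreserving ν).comp (hθ.iterate m)
  have hr (r : ℕ) : ∀ᵐ s ∂ν, Tendsto (fun N : ℕ =>
      (∑ j ∈ Finset.range N, Z (θ^[3 * j + r] s)) / (N : ℝ)) atTop (𝓝 (∫ s, Z s ∂ν)) := by
    have hlt {i j : ℕ} (hij : i < j) :
        IndepFun (Z ∘ θ^[3 * i + r]) (Z ∘ θ^[3 * j + r]) ν := by
      obtain ⟨k, rfl⟩ := Nat.exists_eq_add_of_lt hij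
      have h1 : IndepFun Z ((Z ∘ θ^[3 * k]) ∘ θ^[3]) ν :=
        hind.comp measurable_id (hZ.comp (hθ.iterate _).measurable)
      have h2 := indepFun_comp_of_measurePreserving (hθ.iterate (3 * i + r)) hZ
        ((hZ.comp (hθ.iterate _).measurable).comp (hθ.iterate _).measurable) h1
      convert h2 using 1
      rw [Function.comp_assoc, Function.comp_assoc, ← Function.iterate_add,
        ← Function.iterate_add]
      congr 2
      ring
    have hmean : ∫ s, (Z ∘ θ^[3 * 0 + r]) s ∂ν = ∫ s, Z s ∂ν := by
      have := (hmp (3 * 0 + r)).map_eq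
      rw [← integral_map (f := fun x => x) (hmp (3 * 0 + r)).measurable.aemeasurable
        (by fun_prop), this, integral_map hZ.aemeasurable (by fun_prop)]
    rw [← hmean]
    -- Along one residue class mod 3 the terms are identically distributed and pairwise independent,
    -- which is all this strong law needs.
    refine strong_law_ae_real (fun j => Z ∘ θ^[3 * j + r]) ?_ ?_ ?_
    · exact (hθ.iterate _).integrable_comp_of_integrable hint
    · intro i j hij
      rcases lt_or_gt_of_ne hij with h | h
      · exact hlt h
      · exact (hlt h).symm
    · intro i
      exact ⟨(hmp _).measurable.aemeasurable, (hmp _).measurable.aemeasurable,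
        (hmp _).map_eq.trans (hmp _).map_eq.symm⟩
  filter_upwards [ae_all_iff.2 hr] with s hs
  exact tendsto_average_of_mod_three hs

end Average

/-! ### Convergence of the chain of the last two sensors -/

section Chain

/-- One step of the Markov chain formed by the last two delivering sensors at the instants of the
non-obsolete deliveries, when the delivering sensors are drawn with probabilities `w`. -/
def chainStep (w : Sensor → ℝ) (f : Sensor → Sensor → ℝ) (u v : Sensor) : ℝ :=
  ∑ i, w i * if u = v ∧ i ≠ v then ∑ j, w j * f i j else f v i

theorem sum_sensor {M : Type*} [AddCommMonoid M] (f : Sensor → M) :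
    ∑ i, f i = f Sensor.A + f Sensor.B := by
  change ∑ i ∈ ({Sensor.A, Sensor.B} : Finset Sensor), f i = _
  exact Finset.sum_pair (by simp)

variable {w : Sensor → ℝ}

theorem chainStep_sub_const (hw : w Sensor.A + w Sensor.B = 1) (f : Sensor → Sensor → ℝ) (m : ℝ) :
    chainStep w (fun u v => f u v - m) = fun u v => chainStep w f u v - m := by
  have hB : w Sensor.B = 1 - w Sensor.A := by linarith
  ext u v
  cases u <;> cases v <;> simp [chainStep, sum_sensor, hB] <;> ring

theorem chainStep_const_sub (hw : w Sensor.A + w Sensor.B = 1) (f : Sensor → Sensor → ℝ) (m : ℝ) :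
    chainStep w (fun u v => m - f u v) = fun u v => m - chainStep w f u v := by
  have hB : w Sensor.B = 1 - w Sensor.A := by linarith
  ext u v
  cases u <;> cases v <;> simp [chainStep, sum_sensor, hB] <;> ring

theorem chainStep_nonneg (hw0 : ∀ i, 0 < w i) {f : Sensor → Sensor → ℝ} (hf : ∀ u v, 0 ≤ f u v)
    (u v : Sensor) : 0 ≤ chainStep w f u v := by
  refine Finset.sum_nonneg fun i _ => mul_nonneg (hw0 i).le ?_
  split_ifs
  · exact Finset.sum_nonneg fun j _ => mul_nonneg (hw0 j).le (hf _ _)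
  · exact hf _ _

/-- Doeblin minorization: from every state, two steps reach (A, A) with probability bounded below.
-/
theorem le_chainStep_chainStep (hw : w Sensor.A + w Sensor.B = 1) (hw0 : ∀ i, 0 < w i)
    {f : Sensor → Sensor → ℝ} (hf : ∀ u v, 0 ≤ f u v) (u v : Sensor) :
    w Sensor.A ^ 3 * f Sensor.A Sensor.A ≤ chainStep w (chainStep w f) u v := by
  have hA := hw0 Sensor.A
  have hB := hw0 Sensor.B
  have h1 := hf Sensor.A Sensor.A
  have h2 := hf Sensor.A Sensor.B
  have h3 := hf Sensor.B Sensor.A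
  have h4 := hf Sensor.B Sensor.B
  have hA1 : w Sensor.A ≤ 1 := by linarith
  have h32 : w Sensor.A ^ 3 * f Sensor.A Sensor.A ≤ w Sensor.A ^ 2 * f Sensor.A Sensor.A :=
    mul_le_mul_of_nonneg_right (pow_le_pow_of_le_one hA.le hA1 (by norm_num)) h1
  -- The bound even holds with the square. From (B, B) it is attained only by adding the paths
  -- through (A, A) and (B, B), hence the factor a + b = 1.
  have hfac : w Sensor.A ^ 2 * f Sensor.A Sensor.A =
      w Sensor.A ^ 2 * f Sensor.A Sensor.A * (w Sensor.A + w Sensor.B) := by rw [hw, mul_one]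
  refine h32.trans (sub_nonneg.1 ?_)
  cases u <;> cases v <;> simp [chainStep, sum_sensor, -sub_nonneg]
  · ring_nf; positivity
  · ring_nf; positivity
  · ring_nf; positivity
  · rw [hfac]; ring_nf; positivity

/-- The expectation under the stationary law of the chain, up to normalization. -/
def stationaryMean (w : Sensor → ℝ) (f : Sensor → Sensor → ℝ) : ℝ :=
  w Sensor.A ^ 2 * f Sensor.A Sensor.A + w Sensor.B ^ 2 * f Sensor.B Sensor.B +
    w Sensor.A * w Sensor.B ^ 2 * f Sensor.A Sensor.B +
    w Sensor.A ^ 2 * w Sensor.B * f Sensor.B Sensor.A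

/-- The weights are the probabilities that two consecutive i.i.d. sensors take given values and the
second delivery is a success: (A, B) must be preceded by B, whence ab², while (A, A) needs nothing.
-/
theorem stationaryMean_chainStep (hw : w Sensor.A + w Sensor.B = 1) (f : Sensor → Sensor → ℝ) :
    stationaryMean w (chainStep w f) = stationaryMean w f := by
  have hB : w Sensor.B = 1 - w Sensor.A := by linarith
  simp [stationaryMean, chainStep, sum_sensor, hB]
  ring

/-- Applying the minorization to the distances from g to its lower and upper bounds shrinks the
oscillation by the factor 1 - a³ every two steps. -/
theorem exists_chainStep_iterate_mem (hw : w Sensor.A + w Sensor.B = 1) (hw0 : ∀ i, 0 < w i)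
    {f : Sensor → Sensor → ℝ} (hf : ∀ u v, f u v ∈ Set.Icc (0 : ℝ) 1) (k : ℕ) :
    ∃ m, ∀ u v, (chainStep w)^[2 * k] f u v ∈ Set.Icc m (m + (1 - w Sensor.A ^ 3) ^ k) := by
  induction k with
  | zero => exact ⟨0, by simpa using hf⟩
  | succ k ih =>
    obtain ⟨m, hm⟩ := ih
    set g := (chainStep w)^[2 * k] f with hg
    have hstep : (chainStep w)^[2 * (k + 1)] f = chainStep w (chainStep w g) := by
      rw [hg, ← Function.iterate_succ_apply' (chainStep w),
        ← Function.iterate_succ_apply' (chainStep w)]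
      rfl
    set D := (1 - w Sensor.A ^ 3) ^ k
    refine ⟨m + w Sensor.A ^ 3 * (g Sensor.A Sensor.A - m), fun u v => ?_⟩
    rw [hstep, pow_succ (1 - w Sensor.A ^ 3) k]
    have h1 := le_chainStep_chainStep hw hw0 (f := fun u v => g u v - m)
      (fun u v => sub_nonneg.2 (hm u v).1) u v
    have h2 := le_chainStep_chainStep hw hw0 (f := fun u v => m + D - g u v)
      (fun u v => sub_nonneg.2 (hm u v).2) u v
    rw [chainStep_sub_const hw, chainStep_sub_const hw] at h1
    rw [chainStep_const_sub hw, chainStep_const_sub hw] at h2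
    constructor <;> linarith

theorem chainStep_mem_Icc (hw : w Sensor.A + w Sensor.B = 1) (hw0 : ∀ i, 0 < w i)
    {f : Sensor → Sensor → ℝ} {a b : ℝ} (hf : ∀ u v, f u v ∈ Set.Icc a b) (u v : Sensor) :
    chainStep w f u v ∈ Set.Icc a b := by
  have h1 := chainStep_nonneg hw0 (f := fun u v => f u v - a)
    (fun u v => sub_nonneg.2 (hf u v).1) u v
  have h2 := chainStep_nonneg hw0 (f := fun u v => b - f u v)
    (fun u v => sub_nonneg.2 (hf u v).2) u v
  rw [chainStep_sub_const hw] at h1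
  rw [chainStep_const_sub hw] at h2
  constructor <;> linarith

/-- The normalized stationary mean is unchanged by the iteration and, being a convex combination of
the four values, lies in the shrinking interval that contains them. -/
theorem tendsto_chainStep_iterate (hw : w Sensor.A + w Sensor.B = 1) (hw0 : ∀ i, 0 < w i)
    {f : Sensor → Sensor → ℝ} (hf : ∀ u v, f u v ∈ Set.Icc (0 : ℝ) 1) (u v : Sensor) :
    Tendsto (fun n => (chainStep w)^[n] f u v) atTop
      (𝓝 (stationaryMean w f / (1 - w Sensor.A * w Sensor.B))) := by
  have hA := hw0 Sensor.A
  have hB := hw0 Sensor.B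
  have hpos : 0 < 1 - w Sensor.A * w Sensor.B := by nlinarith
  have hsum : w Sensor.A ^ 2 + w Sensor.B ^ 2 + w Sensor.A * w Sensor.B ^ 2 +
      w Sensor.A ^ 2 * w Sensor.B = 1 - w Sensor.A * w Sensor.B := by
    have : w Sensor.B = 1 - w Sensor.A := by linarith
    rw [this]; ring
  have hstat (n : ℕ) : stationaryMean w ((chainStep w)^[n] f) = stationaryMean w f := by
    induction n with
    | zero => rfl
    | succ n ih => rw [Function.iterate_succ_apply', stationaryMean_chainStep hw, ih]
  have hD0 : 0 ≤ 1 - w Sensor.A ^ 3 := by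
    have := pow_le_one₀ (n := 3) hA.le (by linarith); linarith
  have hD1 : 1 - w Sensor.A ^ 3 < 1 := by have := pow_pos hA 3; linarith
  have hbound (n : ℕ) : dist ((chainStep w)^[n] f u v)
      (stationaryMean w f / (1 - w Sensor.A * w Sensor.B)) ≤ (1 - w Sensor.A ^ 3) ^ (n / 2) := by
    obtain ⟨m, hm⟩ := exists_chainStep_iterate_mem hw hw0 hf (n / 2)
    have hm' : ∀ u v, (chainStep w)^[n] f u v ∈
        Set.Icc m (m + (1 - w Sensor.A ^ 3) ^ (n / 2)) := by
      rcases Nat.mod_two_eq_zero_or_one n with h | h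
      · have : 2 * (n / 2) = n := by lia
        rwa [this] at hm
      · have : n = 2 * (n / 2) + 1 := by lia
        rw [this, Function.iterate_succ_apply', ← this]
        exact chainStep_mem_Icc hw hw0 hm
    refine Real.dist_le_of_mem_Icc (hm' u v) ?_ |>.trans (by simp)
    rw [← hstat n, Set.mem_Icc, le_div_iff₀ hpos, div_le_iff₀ hpos, ← hsum, stationaryMean]
    have hAA := hm' Sensor.A Sensor.A
    have hAB := hm' Sensor.A Sensor.B
    have hBA := hm' Sensor.B Sensor.A
    have hBB := hm' Sensor.B Sensor.B
    rw [mul_comm, mul_comm (m + _)]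
    simp only [add_mul]
    constructor
    · gcongr
      exacts [hAA.1, hBB.1, hAB.1, hBA.1]
    · gcongr
      exacts [hAA.2, hBB.2, hAB.2, hBA.2]
  rw [tendsto_iff_dist_tendsto_zero]
  exact squeeze_zero (fun _ => dist_nonneg) hbound
    ((tendsto_pow_atTop_nhds_zero_of_lt_one hD0 hD1).comp
      (Nat.tendsto_div_const_atTop (by norm_num)))

end Chain

/-- x times the exponential density is 1/r times the Gamma density of shape 2. -/
theorem lintegral_ofReal_expMeasure {r : ℝ} (hr : 0 < r) :
    ∫⁻ x, ENNReal.ofReal x ∂expMeasure r = ENNReal.ofReal (1 / r) := by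
  have h : ∀ x, exponentialPDF r x * ENNReal.ofReal x =
      ENNReal.ofReal (1 / r) * gammaPDF 2 r x := by
    intro x
    rcases lt_or_ge x 0 with hx | hx
    · simp [exponentialPDF_of_neg hx, gammaPDF_of_neg hx]
    · rw [exponentialPDF_of_nonneg hx, gammaPDF_of_nonneg hx,
        ← ENNReal.ofReal_mul (by positivity), ← ENNReal.ofReal_mul (by positivity)]
      congr 1
      rw [Real.Gamma_two, show (2 : ℝ) - 1 = 1 by norm_num, Real.rpow_one, Real.rpow_two]
      field_simp
  rw [lintegral_expMeasure r (by fun_prop), lintegral_congr h,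
    lintegral_const_mul' _ _ ENNReal.ofReal_ne_top, lintegral_gammaPDF_eq_one two_pos hr, mul_one]

theorem expMeasure_Iic_zero (r : ℝ) : expMeasure r (Set.Iic 0) = 0 := by
  have : expMeasure r = volume.withDensity (exponentialPDF r) := rfl
  rw [this, withDensity_apply _ measurableSet_Iic, ← setLIntegral_congr Iio_ae_eq_Iic]
  exact lintegral_exponentialPDF_of_nonpos le_rfl

/-- Put a sensor in front of a sequence of sensors. -/
def seqCons (i : Sensor) (x : ℕ → Sensor) : ℕ → Sensor := fun m => Nat.casesOn m i x

@[fun_prop]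
theorem measurable_seqCons (i : Sensor) : Measurable (seqCons i) := by
  refine measurable_pi_lambda _ fun m => ?_
  cases m <;> simp only [seqCons] <;> fun_prop

theorem sensorAt_eq_seqCons (s : Sensor → ℕ → ℝ) :
    sensorAt s = seqCons (sensorAt s 0) (sensorAt (residual s)) := by
  ext m
  cases m with
  | zero => rfl
  | succ m => exact sensorAt_residual s m

/-- The time between deliveries `m - 1` and `m`. -/
noncomputable def gap (s : Sensor → ℕ → ℝ) (m : ℕ) : ℝ := arrival (residual^[m] s) 0

@[fun_prop]
theorem measurable_sensorAt : Measurable fun s : Sensor → ℕ → ℝ => sensorAt s := by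
  refine measurable_pi_lambda _ fun m => ?_
  have : (fun s : Sensor → ℕ → ℝ => sensorAt s m) = fun s => sensorAt (residual^[m] s) 0 :=
    funext fun s => sensorAt_eq_iterate s m
  rw [this]
  exact measurable_sensorAt_zero.comp (measurable_residual.iterate m)

@[fun_prop]
theorem measurable_gap (m : ℕ) : Measurable fun s : Sensor → ℕ → ℝ => gap s m :=
  measurable_arrival_zero.comp (measurable_residual.iterate m)

theorem measurable_ageBefore (j : ℕ) :
    Measurable fun s => ageBefore (sensorAt s) (gap s) j := by
  unfold ageBefore
  refine ((measurable_gap _).add (measurable_gap _)).add ?_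
  have hset : MeasurableSet {x : ℕ → Sensor | x j = x (j + 1)} :=
    measurableSet_eq_fun (by fun_prop) (by fun_prop)
  exact Measurable.ite (measurable_sensorAt hset) measurable_const (measurable_gap _)

theorem strictMono_epoch {s : Sensor → ℕ → ℝ} (h : ∀ m, 0 < gap s m) : StrictMono (epoch s) :=
  strictMono_nat_of_lt_succ fun m => by
    have := h m
    rw [gap, ← epoch_succ_sub_epoch] at this
    linarith

theorem peakAoI_add_two_eq {s : Sensor → ℕ → ℝ} (h : ∀ m, 0 < gap s m) (n : ℕ) :
    peakAoI s (n + 2) = ageBefore (sensorAt s) (gap s) (successIndex (sensorAt s) n) := by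
  rw [peakAoI_add_two (strictMono_epoch h)]
  simp_rw [epoch_succ_sub_epoch]
  rfl

theorem measurable_seqCons_sensorAt :
    Measurable fun z : (ℝ × Sensor) × (Sensor → ℕ → ℝ) => seqCons z.1.2 (sensorAt z.2) := by
  have : Measurable fun z : Sensor × (Sensor → ℕ → ℝ) => seqCons z.1 (sensorAt z.2) :=
    measurable_from_prod_countable_right fun i => (measurable_seqCons i).comp measurable_sensorAt
  exact this.comp (by fun_prop : Measurable fun z : (ℝ × Sensor) × (Sensor → ℕ → ℝ) =>
    (z.1.2, z.2))

/-- The probability that a given delivery is made by sensor `i`. -/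
noncomputable def share (μ : Sensor → ℝ) (i : Sensor) : ℝ := μ i / (μ Sensor.A + μ Sensor.B)

section Share

variable {μ : Sensor → ℝ} (hμ : ∀ i, 0 < μ i)
include hμ

theorem share_pos (i : Sensor) : 0 < share μ i :=
  div_pos (hμ i) (add_pos (hμ _) (hμ _))

theorem share_add_share : share μ Sensor.A + share μ Sensor.B = 1 := by
  rw [share, share, ← add_div, div_self (add_pos (hμ _) (hμ _)).ne']

theorem one_sub_share_mul_share_pos : 0 < 1 - share μ Sensor.A * share μ Sensor.B := by
  have hA := share_pos hμ Sensor.A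
  have hB := share_pos hμ Sensor.B
  have h := share_add_share hμ
  nlinarith

theorem two_div_eq :
    2 / (μ Sensor.A + μ Sensor.B) / (1 - share μ Sensor.A * share μ Sensor.B) =
      2 * (μ Sensor.A + μ Sensor.B) /
        (μ Sensor.A ^ 2 + μ Sensor.A * μ Sensor.B + μ Sensor.B ^ 2) := by
  have hA := hμ Sensor.A
  have hB := hμ Sensor.B
  have h : 1 - share μ Sensor.A * share μ Sensor.B =
      (μ Sensor.A ^ 2 + μ Sensor.A * μ Sensor.B + μ Sensor.B ^ 2) /
        (μ Sensor.A + μ Sensor.B) ^ 2 := by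
    rw [share, share]
    field_simp
    ring
  rw [h]
  field_simp

theorem ofReal_share_add_ofReal_share :
    ENNReal.ofReal (share μ Sensor.A) + ENNReal.ofReal (share μ Sensor.B) = 1 := by
  rw [← ENNReal.ofReal_add (share_pos hμ _).le (share_pos hμ _).le, share_add_share hμ,
    ENNReal.ofReal_one]

end Share

/-! ### Joint law of gaps and sensors -/

section Law

variable {μ : Sensor → ℝ} [∀ i, IsProbabilityMeasure (expMeasure (μ i))] (hμ : ∀ i, 0 < μ i)
include hμ

theorem lintegral_race_residual {F : (ℝ × Sensor) × (Sensor → ℕ → ℝ) → ℝ≥0∞}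
    (hF : Measurable F) :
    ∫⁻ s, F ((arrival s 0, sensorAt s 0), residual s) ∂pathLaw (fun i => expMeasure (μ i)) =
      ∫⁻ d, ∑ i, ENNReal.ofReal (share μ i) *
        ∫⁻ t, F ((d, i), t) ∂pathLaw (fun i => expMeasure (μ i))
        ∂expMeasure (μ Sensor.A + μ Sensor.B) := by
  have := isProbabilityMeasure_winnerLaw hμ
  have := isProbabilityMeasure_sum hμ
  have hm : Measurable fun s : Sensor → ℕ → ℝ => ((arrival s 0, sensorAt s 0), residual s) := by
    fun_prop
  rw [← lintegral_map hF hm, map_race_residual hμ, lintegral_prod _ hF.aemeasurable, raceLaw,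
    lintegral_prod _ hF.lintegral_prod_right'.aemeasurable]
  simp_rw [lintegral_winnerLaw, sum_sensor, share]

theorem lintegral_sensorAt {φ : (ℕ → Sensor) → ℝ≥0∞} (hφ : Measurable φ) :
    ∫⁻ s, φ (sensorAt s) ∂pathLaw (fun i => expMeasure (μ i)) =
      ∑ i, ENNReal.ofReal (share μ i) *
        ∫⁻ t, φ (seqCons i (sensorAt t)) ∂pathLaw (fun i => expMeasure (μ i)) := by
  have := isProbabilityMeasure_sum hμ
  have hm : Measurable fun z : (ℝ × Sensor) × (Sensor → ℕ → ℝ) =>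
      φ (seqCons z.1.2 (sensorAt z.2)) :=
    hφ.comp measurable_seqCons_sensorAt
  have h0 (s : Sensor → ℕ → ℝ) :
      φ (sensorAt s) = φ (seqCons (sensorAt s 0) (sensorAt (residual s))) := by
    rw [← sensorAt_eq_seqCons]
  rw [lintegral_congr h0, lintegral_race_residual hμ hm]
  simp

/-- The times between deliveries are independent of the sequence of delivering sensors. -/
theorem lintegral_mul_gap {φ : (ℕ → Sensor) → ℝ≥0∞} (hφ : Measurable φ) (k : ℕ) :
    ∫⁻ s, φ (sensorAt s) * ENNReal.ofReal (gap s k) ∂pathLaw (fun i => expMeasure (μ i)) =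
      ENNReal.ofReal (1 / (μ Sensor.A + μ Sensor.B)) *
        ∫⁻ s, φ (sensorAt s) ∂pathLaw (fun i => expMeasure (μ i)) := by
  have := isProbabilityMeasure_sum hμ
  have hsum : 0 < μ Sensor.A + μ Sensor.B := add_pos (hμ _) (hμ _)
  have hcons := measurable_seqCons_sensorAt
  -- Peeling off the first race replaces φ by φ ∘ `seqCons i`, so the hypothesis is needed for all
  -- φ.
  induction k generalizing φ with
  | zero =>
    have h0 (s : Sensor → ℕ → ℝ) : φ (sensorAt s) * ENNReal.ofReal (gap s 0) =
        φ (seqCons (sensorAt s 0) (sensorAt (residual s))) * ENNReal.ofReal (arrival s 0) := by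
      rw [← sensorAt_eq_seqCons]; rfl
    simp_rw [h0]
    rw [lintegral_race_residual hμ (F := fun z => φ (seqCons z.1.2 (sensorAt z.2)) *
      ENNReal.ofReal z.1.1) (by fun_prop), lintegral_sensorAt hμ hφ]
    simp_rw [lintegral_mul_const' _ _ ENNReal.ofReal_ne_top, ← mul_assoc, ← Finset.sum_mul]
    rw [lintegral_const_mul _ (by fun_prop), lintegral_ofReal_expMeasure hsum, mul_comm]
  | succ k ih =>
    have h0 (s : Sensor → ℕ → ℝ) : φ (sensorAt s) * ENNReal.ofReal (gap s (k + 1)) =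
        φ (seqCons (sensorAt s 0) (sensorAt (residual s))) *
          ENNReal.ofReal (gap (residual s) k) := by
      rw [← sensorAt_eq_seqCons]; rfl
    simp_rw [h0]
    rw [lintegral_race_residual hμ (F := fun z => φ (seqCons z.1.2 (sensorAt z.2)) *
      ENNReal.ofReal (gap z.2 k)) (by fun_prop), lintegral_sensorAt hμ hφ]
    simp_rw [fun i => ih (φ := fun x => φ (seqCons i x)) (by fun_prop)]
    rw [lintegral_const, measure_univ, mul_one, Finset.mul_sum]
    exact Finset.sum_congr rfl fun i _ => by ring

theorem measurePreserving_residual :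
    MeasurePreserving residual (pathLaw fun i => expMeasure (μ i))
      (pathLaw fun i => expMeasure (μ i)) := by
  have := isProbabilityMeasure_winnerLaw hμ
  have := isProbabilityMeasure_sum hμ
  have : IsProbabilityMeasure (raceLaw μ) := by unfold raceLaw; infer_instance
  refine ⟨measurable_residual, ?_⟩
  have h := congrArg (Measure.map Prod.snd) (map_race_residual hμ)
  rw [Measure.map_map measurable_snd (by fun_prop), Measure.map_snd_prod, measure_univ,
    one_smul] at h
  exact h

theorem map_race :
    (pathLaw fun i => expMeasure (μ i)).map (fun s => (arrival s 0, sensorAt s 0)) = raceLaw μ := by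
  have := isProbabilityMeasure_winnerLaw hμ
  have := isProbabilityMeasure_sum hμ
  have : IsProbabilityMeasure (raceLaw μ) := by unfold raceLaw; infer_instance
  have h := congrArg (Measure.map Prod.fst) (map_race_residual hμ)
  rw [Measure.map_map measurable_fst (by fun_prop), Measure.map_fst_prod, measure_univ,
    one_smul] at h
  exact h

theorem indepFun_race_residual :
    IndepFun (fun s => (arrival s 0, sensorAt s 0)) residual
      (pathLaw fun i => expMeasure (μ i)) := by
  rw [indepFun_iff_map_prod_eq_prod_map_map (by fun_prop) (by fun_prop), map_race hμ,
    (measurePreserving_residual hμ).map_eq, map_race_residual hμ]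

theorem ae_gap_pos : ∀ᵐ s ∂pathLaw (fun i => expMeasure (μ i)), ∀ m, 0 < gap s m := by
  have := isProbabilityMeasure_winnerLaw hμ
  have h0 : ∀ᵐ s ∂pathLaw (fun i => expMeasure (μ i)), 0 < arrival s 0 := by
    have h1 : ∀ᵐ d ∂expMeasure (μ Sensor.A + μ Sensor.B), 0 < d := by
      simpa [ae_iff] using! expMeasure_Iic_zero _
    have h2 : (pathLaw fun i => expMeasure (μ i)).map (fun s => arrival s 0) =
        expMeasure (μ Sensor.A + μ Sensor.B) := by
      have h := congrArg (Measure.map Prod.fst) (map_race hμ)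
      rw [Measure.map_map measurable_fst (by fun_prop), raceLaw, Measure.map_fst_prod,
        measure_univ, one_smul] at h
      exact h
    rw [← h2] at h1
    exact ae_of_ae_map (by fun_prop) h1
  exact ae_all_iff.2 fun m =>
    ((measurePreserving_residual hμ).iterate m).quasiMeasurePreserving.ae h0

/-- Each gap in the age contributes its mean, since both the weight and the choice of gaps depend on
the sensors only. -/
theorem lintegral_mul_ageBefore {φ : (ℕ → Sensor) → ℝ≥0∞} (hφ : Measurable φ) (j : ℕ) :
    ∫⁻ s, φ (sensorAt s) * ENNReal.ofReal (ageBefore (sensorAt s) (gap s) j)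
        ∂pathLaw (fun i => expMeasure (μ i)) =
      ENNReal.ofReal (1 / (μ Sensor.A + μ Sensor.B)) *
        ∫⁻ s, φ (sensorAt s) * (2 + if sensorAt s j = sensorAt s (j + 1) then 0 else 1)
          ∂pathLaw (fun i => expMeasure (μ i)) := by
  have hset : MeasurableSet {x : ℕ → Sensor | x j = x (j + 1)} :=
    measurableSet_eq_fun (by fun_prop) (by fun_prop)
  have hψ : Measurable fun x : ℕ → Sensor => φ x * if x j = x (j + 1) then 0 else 1 :=
    hφ.mul (Measurable.ite hset measurable_const measurable_const)
  have h1 : ∀ᵐ s ∂pathLaw (fun i => expMeasure (μ i)),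
      φ (sensorAt s) * ENNReal.ofReal (ageBefore (sensorAt s) (gap s) j) =
        (φ (sensorAt s) * ENNReal.ofReal (gap s (j + 2)) +
          φ (sensorAt s) * ENNReal.ofReal (gap s (j + 1))) +
        (φ (sensorAt s) * if sensorAt s j = sensorAt s (j + 1) then 0 else 1) *
          ENNReal.ofReal (gap s j) := by
    filter_upwards [ae_gap_pos hμ] with s hs
    rw [ageBefore]
    split_ifs
    · rw [add_zero, ENNReal.ofReal_add (hs _).le (hs _).le]
      ring
    · rw [ENNReal.ofReal_add (add_pos (hs _) (hs _)).le (hs _).le,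
        ENNReal.ofReal_add (hs _).le (hs _).le]
      ring
  rw [lintegral_congr_ae h1, lintegral_add_left (by fun_prop), lintegral_add_left (by fun_prop),
    lintegral_mul_gap hμ hφ, lintegral_mul_gap hμ hφ, lintegral_mul_gap hμ hψ, ← mul_add, ← mul_add,
    ← lintegral_add_left (by fun_prop), ← lintegral_add_left (by fun_prop)]
  congr 1
  refine lintegral_congr fun s => ?_
  ring

end Law

/-! ### Recursions for the successes and the switch indicator -/

section Success

theorem measurableSet_overtaken : MeasurableSet {x : ℕ → Sensor | Overtaken x 0} :=
  (measurableSet_eq_fun (measurable_pi_apply 0) (measurable_pi_apply 1)).inter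
    (measurableSet_eq_fun (measurable_pi_apply 2) (measurable_pi_apply 1)).compl

theorem successIndex_zero (x : ℕ → Sensor) :
    successIndex x 0 = if Overtaken x 0 then 1 else 0 := by
  split_ifs with h
  · rw [successIndex_of_overtaken h, successIndex_zero_of_not]
    exact not_overtaken_succ h
  · exact successIndex_zero_of_not h

theorem successIndex_succ (x : ℕ → Sensor) (n : ℕ) :
    successIndex x (n + 1) = if Overtaken x 0 then successIndex (fun k => x (k + 2)) n + 2
      else successIndex (fun k => x (k + 1)) n + 1 := by
  split_ifs with h
  · rw [successIndex_of_overtaken h, successIndex_succ_of_not]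
    exact not_overtaken_succ h
  · exact successIndex_succ_of_not h n

@[fun_prop]
theorem measurable_successIndex (n : ℕ) :
    Measurable fun x : ℕ → Sensor => successIndex x n := by
  induction n with
  | zero =>
    simp_rw [successIndex_zero]
    exact Measurable.ite measurableSet_overtaken measurable_const measurable_const
  | succ n ih =>
    simp_rw [successIndex_succ]
    have h (r : ℕ) : Measurable fun x : ℕ → Sensor => successIndex (fun k => x (k + r)) n + r :=
      (measurable_from_top (f := fun m : ℕ => m + r)).comp (ih.comp (by fun_prop))
    exact Measurable.ite measurableSet_overtaken (h 2) (h 1)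

/-- Whether the two deliveries before the `n`-th success came from different sensors. -/
noncomputable def switched (n : ℕ) (x : ℕ → Sensor) : ℝ≥0∞ :=
  if x (successIndex x n) = x (successIndex x n + 1) then 0 else 1

theorem switched_le_one (n : ℕ) (x : ℕ → Sensor) : switched n x ≤ 1 := by
  unfold switched; split_ifs <;> simp

/-- If delivery 2 is obsolete, the success is delivery 3, and deliveries 1 and 2 before it differ.
So only three equal sensors give 0. -/
theorem switched_zero (x : ℕ → Sensor) :
    switched 0 x = if x 0 = x 1 ∧ x 2 = x 1 then 0 else 1 := by
  rw [switched, successIndex_zero]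
  by_cases h : Overtaken x 0
  · simp [h, h.2, h.2.symm]
  · simp only [h, if_false]
    simp only [Overtaken, not_and, not_not, zero_add] at h
    by_cases h' : x 0 = x 1
    · simp [h', h h']
    · simp [h']

theorem switched_succ (n : ℕ) (x : ℕ → Sensor) :
    switched (n + 1) x = if Overtaken x 0 then switched n (fun k => x (k + 2))
      else switched n (fun k => x (k + 1)) := by
  rw [switched, successIndex_succ]
  by_cases h : Overtaken x 0 <;> simp only [h, if_true, if_false] <;> rfl

@[fun_prop]
theorem measurable_switched (n : ℕ) : Measurable (switched n) := by
  induction n with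
  | zero =>
    simp_rw [funext switched_zero]
    exact Measurable.ite ((measurableSet_eq_fun (measurable_pi_apply 0) (measurable_pi_apply 1)).inter
      (measurableSet_eq_fun (measurable_pi_apply 2) (measurable_pi_apply 1))) measurable_const
      measurable_const
  | succ n ih =>
    simp_rw [funext (switched_succ n)]
    exact Measurable.ite measurableSet_overtaken (ih.comp (by fun_prop)) (ih.comp (by fun_prop))

end Success

/-! ### Switch probabilities and the mean peak age -/

section Mean

variable {μ : Sensor → ℝ} [∀ i, IsProbabilityMeasure (expMeasure (μ i))] (hμ : ∀ i, 0 < μ i)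

include hμ in
-- Split by the value of the random index: it is a function of the sensors, so each piece falls
-- under `lintegral_mul_ageBefore`.
theorem lintegral_ageBefore_successIndex (n : ℕ) :
    ∫⁻ s, ENNReal.ofReal (ageBefore (sensorAt s) (gap s) (successIndex (sensorAt s) n))
        ∂pathLaw (fun i => expMeasure (μ i)) =
      ENNReal.ofReal (1 / (μ Sensor.A + μ Sensor.B)) *
        ∫⁻ s, (2 + switched n (sensorAt s)) ∂pathLaw (fun i => expMeasure (μ i)) := by
  let φ : ℕ → (ℕ → Sensor) → ℝ≥0∞ := fun j x => if successIndex x n = j then 1 else 0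
  have hφ (j : ℕ) : Measurable (φ j) :=
    Measurable.ite (measurable_successIndex n (measurableSet_singleton j)) measurable_const
      measurable_const
  have hsplit (x : ℕ → Sensor) (g : ℕ → ℝ≥0∞) : g (successIndex x n) = ∑' j, φ j x * g j := by
    rw [tsum_eq_single (successIndex x n)]
    · simp [φ]
    · intro j hj
      simp [φ, hj.symm]
  have hset (j : ℕ) : MeasurableSet {x : ℕ → Sensor | x j = x (j + 1)} :=
    measurableSet_eq_fun (by fun_prop) (by fun_prop)
  have hite (j : ℕ) : Measurable fun x : ℕ → Sensor =>
      if x j = x (j + 1) then (0 : ℝ≥0∞) else 1 :=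
    Measurable.ite (hset j) measurable_const measurable_const
  have h1 (s : Sensor → ℕ → ℝ) := hsplit (sensorAt s)
    fun j => ENNReal.ofReal (ageBefore (sensorAt s) (gap s) j)
  have h2 (s : Sensor → ℕ → ℝ) : 2 + switched n (sensorAt s) = _ := hsplit (sensorAt s)
    fun j => 2 + if sensorAt s j = sensorAt s (j + 1) then 0 else 1
  simp_rw [h1, h2]
  have m1 (j : ℕ) : Measurable fun s =>
      φ j (sensorAt s) * ENNReal.ofReal (ageBefore (sensorAt s) (gap s) j) :=
    ((hφ j).comp measurable_sensorAt).mul (measurable_ageBefore j).ennreal_ofReal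
  have m2 (j : ℕ) : Measurable fun s : Sensor → ℕ → ℝ =>
      φ j (sensorAt s) * (2 + if sensorAt s j = sensorAt s (j + 1) then 0 else 1) :=
    ((hφ j).comp measurable_sensorAt).mul (((hite j).comp measurable_sensorAt).const_add 2)
  rw [lintegral_tsum fun j => (m1 j).aemeasurable, lintegral_tsum fun j => (m2 j).aemeasurable,
    ← ENNReal.tsum_mul_left]
  exact tsum_congr fun j => lintegral_mul_ageBefore hμ (hφ j) j

variable (μ) in
/-- The probability that the two deliveries before the `n`-th success come from different sensors,
when the two deliveries before the initial instant come from `u` and `v`. -/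
noncomputable def switchProb (n : ℕ) (u v : Sensor) : ℝ≥0∞ :=
  ∫⁻ s, switched n (seqCons u (seqCons v (sensorAt s))) ∂pathLaw (fun i => expMeasure (μ i))

theorem switchProb_le_one (n : ℕ) (u v : Sensor) : switchProb μ n u v ≤ 1 :=
  (lintegral_mono fun _ => switched_le_one n _).trans (by simp)

include hμ

theorem switchProb_zero (u v : Sensor) :
    switchProb μ 0 u v = ∑ i, ENNReal.ofReal (share μ i) * if u = v ∧ i = v then 0 else 1 := by
  rw [switchProb, lintegral_sensorAt hμ
    (φ := fun x => switched 0 (seqCons u (seqCons v x))) (by fun_prop)]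
  have h (i : Sensor) (x : ℕ → Sensor) : switched 0 (seqCons u (seqCons v (seqCons i x))) =
      if u = v ∧ i = v then 0 else 1 := switched_zero _
  simp_rw [h]
  simp

/-- Condition on the next sensor i. If its delivery is obsolete, the one after it, from j, must be a
success, and the chain moves to (i, j); otherwise it moves to (v, i). -/
theorem switchProb_succ (n : ℕ) (u v : Sensor) :
    switchProb μ (n + 1) u v = ∑ i, ENNReal.ofReal (share μ i) *
      if u = v ∧ i ≠ v then ∑ j, ENNReal.ofReal (share μ j) * switchProb μ n i j
      else switchProb μ n v i := by
  rw [switchProb, lintegral_sensorAt hμ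
    (φ := fun x => switched (n + 1) (seqCons u (seqCons v x))) (by fun_prop)]
  refine Finset.sum_congr rfl fun i _ => congrArg _ ?_
  have hiff (x : ℕ → Sensor) : Overtaken (seqCons u (seqCons v (seqCons i x))) 0 ↔
      (u = v ∧ i ≠ v) := Iff.rfl
  simp_rw [switched_succ, hiff]
  split_ifs
  · exact lintegral_sensorAt hμ (φ := fun x => switched n (seqCons i x)) (by fun_prop)
  · rfl

theorem toReal_switchProb (n : ℕ) :
    (fun u v => (switchProb μ n u v).toReal) =
      (chainStep (share μ))^[n] fun u v => (switchProb μ 0 u v).toReal := by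
  have hfin (n u v) : switchProb μ n u v ≠ ∞ :=
    ((switchProb_le_one n u v).trans_lt ENNReal.one_lt_top).ne
  induction n with
  | zero => rfl
  | succ n ih =>
    rw [Function.iterate_succ_apply', ← ih]
    ext u v
    simp only [switchProb_succ hμ, chainStep]
    have hs (f : Sensor → ℝ≥0∞) (hf : ∀ i, f i ≠ ∞) :
        (∑ i, ENNReal.ofReal (share μ i) * f i).toReal = ∑ i, share μ i * (f i).toReal := by
      rw [ENNReal.toReal_sum fun i _ => ENNReal.mul_ne_top ENNReal.ofReal_ne_top (hf i)]
      simp_rw [ENNReal.toReal_mul, ENNReal.toReal_ofReal (share_pos hμ _).le]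
    have hsfin (i : Sensor) : ∑ j, ENNReal.ofReal (share μ j) * switchProb μ n i j ≠ ∞ :=
      (ENNReal.sum_lt_top.2 fun j _ => ENNReal.mul_lt_top ENNReal.ofReal_lt_top
        (hfin n i j).lt_top).ne
    rw [hs _ fun i => by split_ifs; exacts [hsfin i, hfin _ _ _]]
    refine Finset.sum_congr rfl fun i _ => ?_
    rw [apply_ite ENNReal.toReal, hs _ (hfin n i)]

/-- The numerator is the stationary mean of the initial function: a²b + b²a + ab² + a²b = 2ab. -/
theorem tendsto_switchProb (u v : Sensor) :
    Tendsto (fun n => (switchProb μ n u v).toReal) atTop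
      (𝓝 (2 * share μ Sensor.A * share μ Sensor.B /
        (1 - share μ Sensor.A * share μ Sensor.B))) := by
  have h := tendsto_chainStep_iterate (share_add_share hμ) (share_pos hμ)
    (f := fun u v => (switchProb μ 0 u v).toReal)
    (fun u v => ⟨ENNReal.toReal_nonneg, ENNReal.toReal_le_of_le_ofReal zero_le_one
      (by simpa using switchProb_le_one 0 u v)⟩) u v
  simp_rw [← toReal_switchProb hμ] at h
  convert h using 3
  have hA := (share_pos hμ Sensor.A).le
  have hB := (share_pos hμ Sensor.B).le
  have h1 := share_add_share hμ
  have h2 : ENNReal.ofReal (share μ Sensor.A) + ENNReal.ofReal (share μ Sensor.B) = 1 := by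
    rw [← ENNReal.ofReal_add hA hB, h1, ENNReal.ofReal_one]
  simp only [stationaryMean, switchProb_zero hμ, sum_sensor]
  simp [h2, hA, hB]
  have hB' : share μ Sensor.B = 1 - share μ Sensor.A := by linarith
  rw [hB']
  ring

theorem tendsto_lintegral_switched :
    Tendsto (fun n => (∫⁻ s, switched n (sensorAt s)
        ∂pathLaw (fun i => expMeasure (μ i))).toReal) atTop
      (𝓝 (2 * share μ Sensor.A * share μ Sensor.B /
        (1 - share μ Sensor.A * share μ Sensor.B))) := by
  have hfin (n u v) : switchProb μ n u v ≠ ∞ :=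
    ((switchProb_le_one n u v).trans_lt ENNReal.one_lt_top).ne
  have hsum (n : ℕ) : ∫⁻ s, switched n (sensorAt s) ∂pathLaw (fun i => expMeasure (μ i)) =
      ∑ u, ENNReal.ofReal (share μ u) * ∑ v, ENNReal.ofReal (share μ v) * switchProb μ n u v := by
    rw [lintegral_sensorAt hμ (measurable_switched n)]
    refine Finset.sum_congr rfl fun u _ => congrArg _ ?_
    exact lintegral_sensorAt hμ (φ := fun x => switched n (seqCons u x)) (by fun_prop)
  have hreal (n : ℕ) : (∫⁻ s, switched n (sensorAt s)
      ∂pathLaw (fun i => expMeasure (μ i))).toReal =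
      ∑ u, share μ u * ∑ v, share μ v * (switchProb μ n u v).toReal := by
    have hm (i : Sensor) (x : ℝ≥0∞) (hx : x ≠ ∞) : ENNReal.ofReal (share μ i) * x ≠ ∞ :=
      ENNReal.mul_ne_top ENNReal.ofReal_ne_top hx
    have hm' (u : Sensor) : ∑ v, ENNReal.ofReal (share μ v) * switchProb μ n u v ≠ ∞ :=
      ENNReal.sum_ne_top.2 fun v _ => hm v _ (hfin n u v)
    rw [hsum, ENNReal.toReal_sum fun u _ => hm u _ (hm' u)]
    refine Finset.sum_congr rfl fun u _ => ?_
    rw [ENNReal.toReal_mul, ENNReal.toReal_ofReal (share_pos hμ u).le,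
      ENNReal.toReal_sum fun v _ => hm v _ (hfin n u v)]
    simp_rw [ENNReal.toReal_mul, ENNReal.toReal_ofReal (share_pos hμ _).le]
  simp_rw [hreal]
  have h := tendsto_finsetSum Finset.univ fun u _ => (tendsto_finsetSum Finset.univ fun v _ =>
    (tendsto_switchProb hμ u v).const_mul (share μ v)).const_mul (share μ u)
  convert h using 2
  generalize 2 * share μ Sensor.A * share μ Sensor.B / _ = L
  simp only [sum_sensor]
  -- Averaging over two sensors multiplies L by (a + b)², and (a + b)² - 1 = (a + b + 1)(a + b - 1).
  linear_combination
    (-(1 + share μ Sensor.A + share μ Sensor.B) * L) * share_add_share hμ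

end Mean

/-! ### Integrability and convergence of the expected peaks -/

section Peak

variable {μ : Sensor → ℝ} [∀ i, IsProbabilityMeasure (expMeasure (μ i))] (hμ : ∀ i, 0 < μ i)

theorem measurable_ageBefore_successIndex (n : ℕ) :
    Measurable fun s => ageBefore (sensorAt s) (gap s) (successIndex (sensorAt s) n) := by
  have h : Measurable fun z : ℕ × (Sensor → ℕ → ℝ) => ageBefore (sensorAt z.2) (gap z.2) z.1 :=
    measurable_from_prod_countable_right fun j => measurable_ageBefore j
  exact h.comp (((measurable_successIndex n).comp measurable_sensorAt).prodMk measurable_id)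

theorem ageBefore_nonneg {s : Sensor → ℕ → ℝ} (hs : ∀ m, 0 < gap s m) (j : ℕ) :
    0 ≤ ageBefore (sensorAt s) (gap s) j := by
  rw [ageBefore]
  have h0 := hs j
  have h1 := hs (j + 1)
  have h2 := hs (j + 2)
  split_ifs <;> linarith

theorem lintegral_switched_ne_top (n : ℕ) :
    ∫⁻ s, switched n (sensorAt s) ∂pathLaw (fun i => expMeasure (μ i)) ≠ ∞ :=
  ((lintegral_mono fun _ => switched_le_one n _).trans_lt
    (by simp : ∫⁻ _, 1 ∂pathLaw (fun i => expMeasure (μ i)) < ∞)).ne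

include hμ

theorem integrable_gap (k : ℕ) :
    Integrable (fun s => gap s k) (pathLaw fun i => expMeasure (μ i)) := by
  refine ⟨(measurable_gap k).aestronglyMeasurable, ?_⟩
  rw [hasFiniteIntegral_iff_ofReal]
  · have := lintegral_mul_gap hμ (φ := fun _ => 1) measurable_const k
    simp only [one_mul, lintegral_const, measure_univ, mul_one] at this
    rw [this]
    exact ENNReal.ofReal_lt_top
  · filter_upwards [ae_gap_pos hμ] with s hs using (hs k).le

theorem ae_peakAoI_add_two (n : ℕ) :
    (fun s => peakAoI s (n + 2)) =ᵐ[pathLaw fun i => expMeasure (μ i)]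
      fun s => ageBefore (sensorAt s) (gap s) (successIndex (sensorAt s) n) := by
  filter_upwards [ae_gap_pos hμ] with s hs using peakAoI_add_two_eq hs n

theorem integrable_peakAoI (n : ℕ) :
    Integrable (fun s => peakAoI s n) (pathLaw fun i => expMeasure (μ i)) := by
  match n with
  | 0 =>
    refine (integrable_gap hμ 0).congr ?_
    filter_upwards [ae_gap_pos hμ] with s hs
    rw [peakAoI_zero (strictMono_epoch hs)]
    rfl
  | 1 =>
    refine ((integrable_gap hμ 0).add (integrable_gap hμ 1)).congr ?_
    filter_upwards [ae_gap_pos hμ] with s hs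
    rw [peakAoI_one (strictMono_epoch hs), arrival_residual]
    rfl
  | n + 2 =>
    refine Integrable.congr ?_ (ae_peakAoI_add_two hμ n).symm
    refine ⟨(measurable_ageBefore_successIndex n).aestronglyMeasurable, ?_⟩
    rw [hasFiniteIntegral_iff_ofReal, lintegral_ageBefore_successIndex hμ,
      lintegral_add_left measurable_const]
    · refine ENNReal.mul_lt_top ENNReal.ofReal_lt_top (ENNReal.add_lt_top.2 ⟨by simp, ?_⟩)
      exact (lintegral_switched_ne_top n).lt_top
    · filter_upwards [ae_gap_pos hμ] with s hs using ageBefore_nonneg hs _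

theorem integral_peakAoI_add_two (n : ℕ) :
    ∫ s, peakAoI s (n + 2) ∂pathLaw (fun i => expMeasure (μ i)) =
      1 / (μ Sensor.A + μ Sensor.B) *
        (2 + (∫⁻ s, switched n (sensorAt s) ∂pathLaw (fun i => expMeasure (μ i))).toReal) := by
  have hpos : 0 < μ Sensor.A + μ Sensor.B := add_pos (hμ _) (hμ _)
  rw [integral_congr_ae (ae_peakAoI_add_two hμ n), integral_eq_lintegral_of_nonneg_ae ?_
    (measurable_ageBefore_successIndex n).aestronglyMeasurable,
    lintegral_ageBefore_successIndex hμ, lintegral_add_left measurable_const,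
    ENNReal.toReal_mul, ENNReal.toReal_ofReal (by positivity),
    ENNReal.toReal_add (by simp) (lintegral_switched_ne_top n)]
  · simp
  · filter_upwards [ae_gap_pos hμ] with s hs using ageBefore_nonneg hs _

theorem tendsto_integral_peakAoI :
    Tendsto (fun n => ∫ s, peakAoI s n ∂pathLaw (fun i => expMeasure (μ i))) atTop
      (𝓝 (2 * (μ Sensor.A + μ Sensor.B) /
        (μ Sensor.A ^ 2 + μ Sensor.A * μ Sensor.B + μ Sensor.B ^ 2))) := by
  rw [← tendsto_add_atTop_iff_nat 2]
  simp_rw [integral_peakAoI_add_two hμ]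
  convert ((tendsto_lintegral_switched hμ).const_add 2).const_mul
    (1 / (μ Sensor.A + μ Sensor.B)) using 2
  have h := (one_sub_share_mul_share_pos hμ).ne'
  have hpos : μ Sensor.A + μ Sensor.B ≠ 0 := (add_pos (hμ _) (hμ _)).ne'
  rw [← two_div_eq hμ]
  field_simp
  ring

end Peak

/-! ### Almost sure convergence of the averaged peaks -/

section Average

variable {μ : Sensor → ℝ} [∀ i, IsProbabilityMeasure (expMeasure (μ i))] (hμ : ∀ i, 0 < μ i)

theorem sensorAt_iterate_residual (s : Sensor → ℕ → ℝ) (m j : ℕ) :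
    sensorAt (residual^[m] s) j = sensorAt s (m + j) := by
  rw [sensorAt_eq_iterate, ← Function.iterate_add_apply, add_comm, ← sensorAt_eq_iterate]

theorem gap_iterate_residual (s : Sensor → ℕ → ℝ) (m j : ℕ) :
    gap (residual^[m] s) j = gap s (m + j) := by
  rw [gap, ← Function.iterate_add_apply, add_comm, gap]

theorem overtaken_iterate (s : Sensor → ℕ → ℝ) (m : ℕ) :
    Overtaken (sensorAt (residual^[m] s)) 0 ↔ Overtaken (sensorAt s) m := by
  simp only [Overtaken, sensorAt_iterate_residual, zero_add, add_zero]

/-- The age just before delivery `2`, if that delivery is not obsolete. -/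
noncomputable def ageIfSuccess (s : Sensor → ℕ → ℝ) : ℝ :=
  if Overtaken (sensorAt s) 0 then 0 else ageBefore (sensorAt s) (gap s) 0

/-- The indicator that delivery `2` is not obsolete. -/
noncomputable def success (s : Sensor → ℕ → ℝ) : ℝ := if Overtaken (sensorAt s) 0 then 0 else 1

theorem ageIfSuccess_iterate (s : Sensor → ℕ → ℝ) (m : ℕ) :
    ageIfSuccess (residual^[m] s) =
      if ¬ Overtaken (sensorAt s) m then ageBefore (sensorAt s) (gap s) m else 0 := by
  rw [ageIfSuccess, ← ite_not]
  simp only [overtaken_iterate, ageBefore, sensorAt_iterate_residual, gap_iterate_residual,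
    zero_add, add_zero]

theorem success_iterate (s : Sensor → ℕ → ℝ) (m : ℕ) :
    success (residual^[m] s) = if ¬ Overtaken (sensorAt s) m then 1 else 0 := by
  rw [success, ← ite_not]
  simp only [overtaken_iterate]

@[fun_prop]
theorem measurable_ageIfSuccess : Measurable ageIfSuccess :=
  Measurable.ite (measurable_sensorAt measurableSet_overtaken) measurable_const
    (measurable_ageBefore 0)

@[fun_prop]
theorem measurable_success : Measurable success :=
  Measurable.ite (measurable_sensorAt measurableSet_overtaken) measurable_const measurable_const

theorem sum_ite_eq_sum_nth (p : ℕ → Prop) [DecidablePred p] (g : ℕ → ℝ) (M : ℕ) :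
    ∑ m ∈ Finset.range M, (if p m then g m else 0) =
      ∑ k ∈ Finset.range (Nat.count p M), g (Nat.nth p k) := by
  induction M with
  | zero => simp
  | succ M ih =>
    rw [Finset.sum_range_succ, ih, Nat.count_succ]
    split_ifs with h
    · rw [Finset.sum_range_succ, Nat.nth_count h]
    · simp

/-- Evaluate both averages at N = `successIndex` of n: exactly n successes lie below it, so the
quotient is the average over the first n successes. -/
theorem tendsto_sum_ageBefore {s : Sensor → ℕ → ℝ} {a b : ℝ} (hb : b ≠ 0)
    (ha : Tendsto (fun N : ℕ => (∑ m ∈ Finset.range N, ageIfSuccess (residual^[m] s)) / (N : ℝ))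
      atTop (𝓝 a))
    (hb' : Tendsto (fun N : ℕ => (∑ m ∈ Finset.range N, success (residual^[m] s)) / (N : ℝ))
      atTop (𝓝 b)) :
    Tendsto (fun n : ℕ => (∑ k ∈ Finset.range n,
      ageBefore (sensorAt s) (gap s) (successIndex (sensorAt s) k)) / (n : ℝ)) atTop
      (𝓝 (a / b)) := by
  have hJ : Tendsto (successIndex (sensorAt s)) atTop atTop :=
    (Nat.nth_strictMono (infinite_not_overtaken _)).tendsto_atTop
  refine ((ha.comp hJ).div (hb'.comp hJ) hb).congr' ?_
  filter_upwards [hJ.eventually_gt_atTop 0] with n hn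
  have hn' : (successIndex (sensorAt s) n : ℝ) ≠ 0 := by exact_mod_cast hn.ne'
  simp only [Function.comp_apply, Pi.div_apply, ageIfSuccess_iterate, success_iterate]
  rw [div_div_div_cancel_right₀ hn', sum_ite_eq_sum_nth, sum_ite_eq_sum_nth, count_successIndex]
  simp [successIndex]

theorem tendsto_average_of_add_two {z : ℕ → ℝ} {c : ℝ}
    (h : Tendsto (fun n : ℕ => (∑ k ∈ Finset.range n, z (k + 2)) / (n : ℝ)) atTop (𝓝 c)) :
    Tendsto (fun n : ℕ => (∑ k ∈ Finset.range n, z k) / (n : ℝ)) atTop (𝓝 c) := by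
  rw [← tendsto_add_atTop_iff_nat 2]
  have h1 := tendsto_const_div_atTop_nhds_zero_nat (z 0 + z 1)
  have h2 : Tendsto (fun n : ℕ => (n : ℝ) / (n + (2 : ℕ))) atTop (𝓝 1) :=
    tendsto_natCast_div_add_atTop _
  have h3 := (h.add h1).mul h2
  rw [add_zero, mul_one] at h3
  refine h3.congr' ?_
  filter_upwards [eventually_gt_atTop 0] with n hn
  have hn' : (n : ℝ) ≠ 0 := by exact_mod_cast hn.ne'
  rw [Finset.sum_range_succ', Finset.sum_range_succ']
  push_cast
  field_simp
  ring

include hμ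

/-- Apply `indepFun_prodMk_comp` twice to collect three successive races. -/
theorem indepFun_iterate_residual {g : (ℝ × Sensor) × (ℝ × Sensor) × (ℝ × Sensor) → ℝ}
    (hg : Measurable g) :
    IndepFun (fun s => g ((gap s 0, sensorAt s 0), (gap s 1, sensorAt s 1),
      (gap s 2, sensorAt s 2))) residual^[3] (pathLaw fun i => expMeasure (μ i)) := by
  have hθ := measurePreserving_residual hμ
  have h1 := indepFun_race_residual hμ
  have hr : Measurable fun s : Sensor → ℕ → ℝ => (arrival s 0, sensorAt s 0) := by fun_prop
  have h2 := indepFun_prodMk_comp hθ hr hr hθ.measurable h1 h1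
  have h3 := indepFun_prodMk_comp hθ hr (by fun_prop) (hθ.measurable.comp hθ.measurable) h1 h2
  have h4 := h3.comp hg measurable_id
  convert h4 using 1
  · ext s
    have e1 : sensorAt s 1 = sensorAt (residual s) 0 := sensorAt_residual s 0
    have e2 : sensorAt s 2 = sensorAt (residual (residual s)) 0 := by
      rw [sensorAt_residual, sensorAt_residual]
    simp only [e1, e2]
    rfl
  · rfl

theorem indepFun_ageIfSuccess :
    IndepFun ageIfSuccess residual^[3] (pathLaw fun i => expMeasure (μ i)) := by
  refine indepFun_iterate_residual hμ (g := fun z =>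
    if z.1.2 = z.2.1.2 ∧ z.2.2.2 ≠ z.2.1.2 then 0
    else z.2.2.1 + z.2.1.1 + if z.1.2 = z.2.1.2 then 0 else z.1.1) ?_
  have h1 : MeasurableSet {z : (ℝ × Sensor) × (ℝ × Sensor) × (ℝ × Sensor) | z.1.2 = z.2.1.2} :=
    measurableSet_eq_fun (by fun_prop) (by fun_prop)
  have h2 : MeasurableSet {z : (ℝ × Sensor) × (ℝ × Sensor) × (ℝ × Sensor) | z.2.2.2 = z.2.1.2} :=
    measurableSet_eq_fun (by fun_prop) (by fun_prop)
  exact Measurable.ite (h1.inter h2.compl) measurable_const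
    ((by fun_prop : Measurable fun z : (ℝ × Sensor) × (ℝ × Sensor) × (ℝ × Sensor) =>
      z.2.2.1 + z.2.1.1).add (Measurable.ite h1 measurable_const (by fun_prop)))

theorem indepFun_success :
    IndepFun success residual^[3] (pathLaw fun i => expMeasure (μ i)) := by
  refine indepFun_iterate_residual hμ (g := fun z =>
    if z.1.2 = z.2.1.2 ∧ z.2.2.2 ≠ z.2.1.2 then 0 else 1) ?_
  have h1 : MeasurableSet {z : (ℝ × Sensor) × (ℝ × Sensor) × (ℝ × Sensor) | z.1.2 = z.2.1.2} :=
    measurableSet_eq_fun (by fun_prop) (by fun_prop)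
  have h2 : MeasurableSet {z : (ℝ × Sensor) × (ℝ × Sensor) × (ℝ × Sensor) | z.2.2.2 = z.2.1.2} :=
    measurableSet_eq_fun (by fun_prop) (by fun_prop)
  exact Measurable.ite (h1.inter h2.compl) measurable_const measurable_const

theorem lintegral_three_sensors {φ : (ℕ → Sensor) → ℝ≥0∞} (hφ : Measurable φ)
    {g : Sensor → Sensor → Sensor → ℝ≥0∞} (hg : ∀ x, φ x = g (x 0) (x 1) (x 2)) :
    ∫⁻ s, φ (sensorAt s) ∂pathLaw (fun i => expMeasure (μ i)) =
      ∑ i, ENNReal.ofReal (share μ i) * ∑ j, ENNReal.ofReal (share μ j) *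
        ∑ k, ENNReal.ofReal (share μ k) * g i j k := by
  rw [lintegral_sensorAt hμ hφ]
  refine Finset.sum_congr rfl fun i _ => congrArg _ ?_
  rw [lintegral_sensorAt hμ (φ := fun x => φ (seqCons i x)) (by fun_prop)]
  refine Finset.sum_congr rfl fun j _ => congrArg _ ?_
  rw [lintegral_sensorAt hμ (φ := fun x => φ (seqCons i (seqCons j x))) (by fun_prop)]
  refine Finset.sum_congr rfl fun k _ => congrArg _ ?_
  have (x : ℕ → Sensor) : φ (seqCons i (seqCons j (seqCons k x))) = g i j k := hg _
  simp_rw [this]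
  simp

theorem lintegral_ageIfSuccess :
    ∫⁻ s, ENNReal.ofReal (ageIfSuccess s) ∂pathLaw (fun i => expMeasure (μ i)) =
      ENNReal.ofReal (2 / (μ Sensor.A + μ Sensor.B)) := by
  have hφ : Measurable fun x : ℕ → Sensor => if Overtaken x 0 then (0 : ℝ≥0∞) else 1 :=
    Measurable.ite measurableSet_overtaken measurable_const measurable_const
  have hset : MeasurableSet {x : ℕ → Sensor | x 0 = x 1} :=
    measurableSet_eq_fun (by fun_prop) (by fun_prop)
  have h0 (s : Sensor → ℕ → ℝ) : ENNReal.ofReal (ageIfSuccess s) =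
      (if Overtaken (sensorAt s) 0 then 0 else 1) *
        ENNReal.ofReal (ageBefore (sensorAt s) (gap s) 0) := by
    rw [ageIfSuccess]; split_ifs <;> simp
  rw [lintegral_congr h0, lintegral_mul_ageBefore hμ hφ,
    lintegral_three_sensors hμ (φ := fun x => (if Overtaken x 0 then 0 else 1) *
      (2 + if x 0 = x (0 + 1) then 0 else 1))
      (hφ.mul ((Measurable.ite hset measurable_const measurable_const).const_add 2))
      (g := fun i j k => (if i = j ∧ k ≠ j then 0 else 1) * (2 + if i = j then 0 else 1))
      (fun x => rfl)]
  have h1 := ofReal_share_add_ofReal_share hμ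
  simp only [sum_sensor]
  generalize ENNReal.ofReal (share μ Sensor.A) = a at *
  generalize ENNReal.ofReal (share μ Sensor.B) = b at *
  -- Summing over three sensors gives 2(a³ + b³) + 3·2ab(a + b), which is 2(a + b)³.
  have h2 : 2 * (a + b) ^ 3 = 2 := by rw [h1]; simp
  rw [show 2 / (μ Sensor.A + μ Sensor.B) = 1 / (μ Sensor.A + μ Sensor.B) * 2 by ring,
    ENNReal.ofReal_mul (one_div_pos.2 (add_pos (hμ _) (hμ _))).le]
  congr 1
  rw [ENNReal.ofReal_ofNat]
  refine Eq.trans ?_ h2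
  simp
  ring

theorem lintegral_success :
    ∫⁻ s, ENNReal.ofReal (success s) ∂pathLaw (fun i => expMeasure (μ i)) =
      ENNReal.ofReal (1 - share μ Sensor.A * share μ Sensor.B) := by
  have hφ : Measurable fun x : ℕ → Sensor => if Overtaken x 0 then (0 : ℝ≥0∞) else 1 :=
    Measurable.ite measurableSet_overtaken measurable_const measurable_const
  have h0 (s : Sensor → ℕ → ℝ) : ENNReal.ofReal (success s) =
      if Overtaken (sensorAt s) 0 then 0 else 1 := by
    rw [success]; split_ifs <;> simp
  rw [lintegral_congr h0, lintegral_three_sensors hμ hφ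
    (g := fun i j k => if i = j ∧ k ≠ j then 0 else 1) (fun x => rfl)]
  have hA := (share_pos hμ Sensor.A).le
  have hB := (share_pos hμ Sensor.B).le
  have h1 := ofReal_share_add_ofReal_share hμ
  -- This subtraction-free form of 1 - ab can be handled in `ℝ≥0∞`.
  have h2 : 1 - share μ Sensor.A * share μ Sensor.B =
      share μ Sensor.A * share μ Sensor.A + share μ Sensor.A * share μ Sensor.B +
        share μ Sensor.B * share μ Sensor.B := by
    have : share μ Sensor.B = 1 - share μ Sensor.A := by linarith [share_add_share hμ]
    rw [this]; ring
  rw [h2, ENNReal.ofReal_add (by positivity) (by positivity),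
    ENNReal.ofReal_add (by positivity) (by positivity), ENNReal.ofReal_mul hA,
    ENNReal.ofReal_mul hA, ENNReal.ofReal_mul hB]
  simp only [sum_sensor]
  generalize ENNReal.ofReal (share μ Sensor.A) = a at *
  generalize ENNReal.ofReal (share μ Sensor.B) = b at *
  simp only [ne_eq, reduceCtorEq, not_false_eq_true, not_true_eq_false, and_true, and_false,
    if_true, if_false, mul_one, mul_zero, zero_add, add_zero, h1]
  calc a * (a * a + b) + b * (a + b * b)
      = a ^ 3 + b ^ 3 + a * b * 1 + a * b := by ring
    _ = (a ^ 2 + b ^ 2) * (a + b) + a * b := by rw [← h1]; ring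
    _ = a * a + a * b + b * b := by rw [h1]; ring

theorem ae_ageIfSuccess_nonneg :
    0 ≤ᵐ[pathLaw fun i => expMeasure (μ i)] ageIfSuccess := by
  filter_upwards [ae_gap_pos hμ] with s hs
  rw [ageIfSuccess]
  split_ifs
  · exact le_rfl
  · exact ageBefore_nonneg hs 0

theorem ae_tendsto_average_peakAoI :
    ∀ᵐ s ∂pathLaw (fun i => expMeasure (μ i)), Tendsto
      (fun N : ℕ => (∑ n ∈ Finset.range N, peakAoI s n) / (N : ℝ)) atTop
      (𝓝 (2 * (μ Sensor.A + μ Sensor.B) /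
        (μ Sensor.A ^ 2 + μ Sensor.A * μ Sensor.B + μ Sensor.B ^ 2))) := by
  have hpos : 0 < μ Sensor.A + μ Sensor.B := add_pos (hμ _) (hμ _)
  have hθ := measurePreserving_residual hμ
  have hb := one_sub_share_mul_share_pos hμ
  have hsuccess : ∀ s, 0 ≤ success s := fun s => by rw [success]; split_ifs <;> simp
  have i1 : Integrable ageIfSuccess (pathLaw fun i => expMeasure (μ i)) := by
    refine ⟨measurable_ageIfSuccess.aestronglyMeasurable, ?_⟩
    rw [hasFiniteIntegral_iff_ofReal (ae_ageIfSuccess_nonneg hμ), lintegral_ageIfSuccess hμ]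
    exact ENNReal.ofReal_lt_top
  have i2 : Integrable success (pathLaw fun i => expMeasure (μ i)) := by
    refine ⟨measurable_success.aestronglyMeasurable, ?_⟩
    rw [hasFiniteIntegral_iff_ofReal (ae_of_all _ hsuccess), lintegral_success hμ]
    exact ENNReal.ofReal_lt_top
  have e1 := integral_eq_lintegral_of_nonneg_ae (ae_ageIfSuccess_nonneg hμ)
    measurable_ageIfSuccess.aestronglyMeasurable
  have e2 := integral_eq_lintegral_of_nonneg_ae (ae_of_all _ hsuccess)
    (measurable_success.aestronglyMeasurable (μ := pathLaw fun i => expMeasure (μ i)))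
  rw [lintegral_ageIfSuccess hμ, ENNReal.toReal_ofReal (by positivity)] at e1
  rw [lintegral_success hμ, ENNReal.toReal_ofReal hb.le] at e2
  have l1 := strong_law_shift hθ measurable_ageIfSuccess i1 (indepFun_ageIfSuccess hμ)
  have l2 := strong_law_shift hθ measurable_success i2 (indepFun_success hμ)
  rw [e1] at l1
  rw [e2] at l2
  filter_upwards [l1, l2, ae_gap_pos hμ] with s h1 h2 hs
  refine tendsto_average_of_add_two ?_
  simp_rw [peakAoI_add_two_eq hs, ← two_div_eq hμ]
  exact tendsto_sum_ageBefore hb.ne' h1 h2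

end Average

/-- Transfers results from the canonical path space to arbitrary independent service times. -/
theorem hasLaw_path {Ω : Type*} [MeasurableSpace Ω] {P : Measure Ω}
    (law : Sensor → Measure ℝ) [∀ i, IsProbabilityMeasure (law i)]
    {S : Sensor → ℕ → Ω → ℝ} (hlaw : ∀ i k, HasLaw (S i k) (law i) P)
    (hindep : iIndepFun (fun p : Sensor × ℕ => S p.1 p.2) P) :
    HasLaw (fun ω i k => S i k ω) (pathLaw law) P := by
  have hm : AEMeasurable (fun ω (p : Sensor × ℕ) => S p.1 p.2 ω) P :=
    aemeasurable_pi_iff.2 fun p => (hlaw p.1 p.2).aemeasurable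
  have h := hindep.hasLaw_infinitePi (μ := fun p => law p.1) (fun p => hlaw p.1 p.2) hm
  have hc : Measurable fun (s : Sensor × ℕ → ℝ) i k => s (i, k) := by fun_prop
  refine ⟨hc.comp_aemeasurable hm, ?_⟩
  rw [pathLaw, ← h.map_eq, AEMeasurable.map_map_of_aemeasurable hc.aemeasurable hm]
  rfl

end DualQueue

theorem proposition1 {Ω : Type*} [MeasurableSpace Ω] (P : Measure Ω) [IsProbabilityMeasure P]
    (μ : DualQueue.Sensor → ℝ) (hμ : ∀ i, 0 < μ i)
    (S : DualQueue.Sensor → ℕ → Ω → ℝ)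
    (hlaw : ∀ i k, HasLaw (S i k) (expMeasure (μ i)) P)
    (hindep : iIndepFun (fun p : DualQueue.Sensor × ℕ => S p.1 p.2) P) :
    (∀ᵐ ω ∂P, Tendsto
      (fun N : ℕ => (∑ n ∈ Finset.range N, DualQueue.peakAoI (fun i k => S i k ω) n) / (N : ℝ))
      atTop
      (𝓝 (2 * (μ DualQueue.Sensor.A + μ DualQueue.Sensor.B) /
        (μ DualQueue.Sensor.A ^ 2 + μ DualQueue.Sensor.A * μ DualQueue.Sensor.B
          + μ DualQueue.Sensor.B ^ 2)))) ∧
    (∀ n : ℕ, Integrable (fun ω => DualQueue.peakAoI (fun i k => S i k ω) n) P) ∧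
    Tendsto (fun n : ℕ => ∫ ω, DualQueue.peakAoI (fun i k => S i k ω) n ∂P)
      atTop
      (𝓝 (2 * (μ DualQueue.Sensor.A + μ DualQueue.Sensor.B) /
        (μ DualQueue.Sensor.A ^ 2 + μ DualQueue.Sensor.A * μ DualQueue.Sensor.B
          + μ DualQueue.Sensor.B ^ 2))) := by
  have (i : DualQueue.Sensor) : IsProbabilityMeasure (expMeasure (μ i)) :=
    isProbabilityMeasure_expMeasure (hμ i)
  have h := DualQueue.hasLaw_path (fun i => expMeasure (μ i)) hlaw hindep
  have hint := DualQueue.integrable_peakAoI hμ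
  simp_rw [← h.map_eq] at hint
  refine ⟨?_, fun n => (hint n).comp_aemeasurable h.aemeasurable, ?_⟩
  · have h1 := DualQueue.ae_tendsto_average_peakAoI hμ
    rw [← h.map_eq] at h1
    exact ae_of_ae_map h.aemeasurable h1
  · have h1 := DualQueue.tendsto_integral_peakAoI hμ
    rw [← h.map_eq] at h1
    refine h1.congr fun n => ?_
    exact integral_map h.aemeasurable (hint n).aestronglyMeasurable
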